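/- Let $K$ be a perfect field with algebraic closure $\bar K$ and absolute Galois group $G_K$, and let $E/K$ be an elliptic curve given by a Weierstrass equation. For $P\in E(\bar K)$ let $v_P$ be the normalized valuation of the function field $\bar K(E)$ at $P$. Let $\mathrm{Div}^0(E)$ be the group of divisors of degree zero on $E(\bar K)$ and $\mathrm{Princ}(E)$ the group of principal divisors. Choose for each $P\in E(\bar K)$ a uniformizer $t_P\in\bar K(E)$ at $P$ such that the map $P\mapsto t_P$ is Galois-equivariant. For $f\in\bar K(E)^\times$ and $D=\sum_P v_P(D)\,(P)\in\mathrm{Div}^0(E)$ put $$\langle \mathrm{div}(f),D\rangle_1=\prod_P\bigl(f\,t_P^{-v_P(f)}\bigr)(P)^{v_P(D)},\qquad \langle D,\mathrm{div}(f)\rangle_2=\prod_P(-1)^{v_P(f)v_P(D)}\bigl(f\,t_P^{-v_P(f)}\bigr)(P)^{v_P(D)}.$$ Then every nonzero $f$ has a divisor, which is of degree zero, so $\mathrm{Princ}(E)\subseteq\mathrm{Div}^0(E)$; the two expressions depend on $f$ only through $\mathrm{div}(f)$, and define Galois-equivariant bimultiplicative pairings $$\langle\cdot,\cdot\rangle_1\colon\mathrm{Princ}(E)\times\mathrm{Div}^0(E)\to\bar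 K^\times,\qquad \langle\cdot,\cdot\rangle_2\colon\mathrm{Div}^0(E)\times\mathrm{Princ}(E)\to\bar K^\times;$$ and $\langle A,B\rangle_1=\langle A,B\rangle_2$ for all $A,B\in\mathrm{Princ}(E)$. -/

import Mathlib

namespace EllPairing

open Polynomial WeierstrassCurve

noncomputable section

/-- The absolute Galois group `G_K`, as the automorphism group of an algebraic closure. -/
abbrev GalK (K : Type*) [Field K] := AlgebraicClosure K ≃ₐ[K] AlgebraicClosure K

section Curve

variable {K : Type*} [Field K] (W : WeierstrassCurve K)

/-- The base change of the curve to the algebraic closure. -/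
abbrev Ebar : WeierstrassCurve.Affine (AlgebraicClosure K) :=
  WeierstrassCurve.baseChange W (AlgebraicClosure K)

/-- `E(K̄)`, including the point at infinity `0`. -/
abbrev Pt := (Ebar W).Point

/-- The affine coordinate ring of `E` over `K̄`. -/
abbrev CoordRing := (Ebar W).CoordinateRing

/-- The function field `K̄(E)`. -/
abbrev FunField := (Ebar W).FunctionField

/-- Constants as rational functions. -/
def const : AlgebraicClosure K →+* FunField W :=
  algebraMap (AlgebraicClosure K) (FunField W)

/-! ### Galois actions -/

lemma map_polynomial_eq (σ : GalK K) :
    (Ebar W).polynomial.map (mapRingHom (σ : AlgebraicClosure K →+* AlgebraicClosure K)) =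
      (Ebar W).polynomial :=
  (Affine.baseChange_polynomial (W := W) (σ : AlgebraicClosure K →ₐ[K] AlgebraicClosure K)).symm

/-- `σ ∈ G_K` acting on the coordinate ring: it acts on the coefficients and fixes the coordinate
functions `x` and `y`. -/
def galCoord (σ : GalK K) : CoordRing W ≃+* CoordRing W :=
  AdjoinRoot.mapRingEquiv (mapEquiv (σ : AlgebraicClosure K ≃+* AlgebraicClosure K))
    (Ebar W).polynomial (Ebar W).polynomial (Associated.of_eq (map_polynomial_eq W σ))

/-- `σ ∈ G_K` acting on the function field. -/
def galFun (σ : GalK K) : FunField W ≃+* FunField W :=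
  IsFractionRing.ringEquivOfRingEquiv (galCoord W σ)

variable {W}

open scoped Classical in
/-- `σ ∈ G_K` acting on points, coordinate by coordinate. -/
def galPt (σ : GalK K) (P : Pt W) : Pt W :=
  Affine.Point.map (W' := W) (σ : AlgebraicClosure K →ₐ[K] AlgebraicClosure K) P

/-! ### Orders of vanishing and values -/

/-- The order of vanishing at `P` of a nonzero regular function `a` on the affine curve.
At an affine point it is the largest `n` with `a ∈ 𝔪_P ^ n`, where `𝔪_P = ⟨x - x_P, y - y_P⟩`.
At infinity it is minus the degree of the norm of `a` from `K̄[E]` to `K̄[x]`: writing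
`a = p(x) + q(x) y`, this is `- max (2 deg p) (2 deg q + 3)`, as `x` and `y` have poles of order
`2` and `3`. -/
def ordReg (P : Pt W) (a : CoordRing W) : ℤ :=
  match P with
  | .zero => -((Algebra.norm (AlgebraicClosure K)[X] a).natDegree : ℤ)
  | @Affine.Point.some _ _ _ x y _ =>
      ((sSup {n : ℕ | a ∈ (Affine.CoordinateRing.XYIdeal (Ebar W) x (C y)) ^ n} : ℕ) : ℤ)

/-- The normalized valuation `v_P(f)` of a nonzero rational function `f = a / b`, namely
`v_P(a) - v_P(b)`. -/
def ord (P : Pt W) (f : FunField W) : ℤ :=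
  ordReg P (IsLocalization.sec (nonZeroDivisors (CoordRing W)) f).1 -
    ordReg P ((IsLocalization.sec (nonZeroDivisors (CoordRing W)) f).2 : CoordRing W)

open scoped Classical in
/-- The value `f(P) ∈ K̄` of a rational function `f` that is regular at `P`: the constant `c` such
that `f - c` is zero or vanishes at `P`. -/
def value (P : Pt W) (f : FunField W) : AlgebraicClosure K :=
  if h : ∃ c : AlgebraicClosure K, f = const W c ∨ 0 < ord P (f - const W c) then h.choose else 0

/-! ### Divisors -/

variable (W) in
/-- Divisors on `E` over `K̄`. -/
abbrev Divisor := Pt W →₀ ℤ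

/-- The degree of a divisor. -/
def degree (D : Divisor W) : ℤ := D.sum fun _ n => n

/-- `σ ∈ G_K` acting on divisors: `∑ n_P (P) ↦ ∑ n_P (σ P)`. -/
def galDiv (σ : GalK K) (D : Divisor W) : Divisor W := D.mapDomain (galPt σ)

/-- `D = div f` (for a nonzero rational function `f`). -/
def IsDivOf (D : Divisor W) (f : FunField W) : Prop := f ≠ 0 ∧ ∀ P, D P = ord P f

variable (W) in
/-- `Div⁰(E)`. -/
def Div0 : Set (Divisor W) := {D | degree D = 0}

variable (W) in
/-- `Princ(E)`. -/
def Princ : Set (Divisor W) := {D | ∃ f, IsDivOf D f}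

/-! ### The pairings -/

variable (W) in
/-- A Galois-equivariant choice of a uniformizer `t_P` at each point `P ∈ E(K̄)`. -/
structure Uniformizers where
  /-- The uniformizer at a point. -/
  t : Pt W → FunField W
  ne_zero : ∀ P, t P ≠ 0
  ord_eq_one : ∀ P, ord P (t P) = 1
  equivariant : ∀ (σ : GalK K) (P : Pt W), t (galPt σ P) = galFun W σ (t P)

/-- `(f t_P ^ (-v_P(f)))(P)`. -/
def leadCoeff (u : Uniformizers W) (f : FunField W) (P : Pt W) : AlgebraicClosure K :=
  value P (f * u.t P ^ (-ord P f))

/-- `∏_P (f t_P ^ (-v_P(f)))(P) ^ v_P(D)`. -/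
def formula₁ (u : Uniformizers W) (f : FunField W) (D : Divisor W) : AlgebraicClosure K :=
  D.prod fun P n => leadCoeff u f P ^ n

/-- `∏_P (-1) ^ (v_P(f) v_P(D)) (f t_P ^ (-v_P(f)))(P) ^ v_P(D)`. -/
def formula₂ (u : Uniformizers W) (D : Divisor W) (f : FunField W) : AlgebraicClosure K :=
  D.prod fun P n => (-1) ^ (ord P f * n) * leadCoeff u f P ^ n

open scoped Classical in
/-- `⟨A, D⟩₁` for `A ∈ Princ(E)` and `D ∈ Div⁰(E)`, computed with some `f` such that
`A = div f`. -/
def pairing₁ (u : Uniformizers W) (A D : Divisor W) : AlgebraicClosure K :=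
  if h : ∃ f, IsDivOf A f then formula₁ u h.choose D else 1

open scoped Classical in
/-- `⟨D, A⟩₂` for `D ∈ Div⁰(E)` and `A ∈ Princ(E)`, computed with some `f` such that
`A = div f`. -/
def pairing₂ (u : Uniformizers W) (D A : Divisor W) : AlgebraicClosure K :=
  if h : ∃ f, IsDivOf A f then formula₂ u D h.choose else 1

/-- `p` restricts to a Galois-equivariant bimultiplicative pairing `H₁ × H₂ → K̄ˣ`, where `H₁` and
`H₂` are Galois-stable groups of divisors. -/
structure IsGaloisPairing (H₁ H₂ : Set (Divisor W))
    (p : Divisor W → Divisor W → AlgebraicClosure K) : Prop where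
  subgroup_left : ∃ S : AddSubgroup (Divisor W), (S : Set (Divisor W)) = H₁
  subgroup_right : ∃ S : AddSubgroup (Divisor W), (S : Set (Divisor W)) = H₂
  stable_left : ∀ σ : GalK K, ∀ D ∈ H₁, galDiv σ D ∈ H₁
  stable_right : ∀ σ : GalK K, ∀ D ∈ H₂, galDiv σ D ∈ H₂
  ne_zero : ∀ D ∈ H₁, ∀ D' ∈ H₂, p D D' ≠ 0
  add_left : ∀ D₁ ∈ H₁, ∀ D₂ ∈ H₁, ∀ D' ∈ H₂, p (D₁ + D₂) D' = p D₁ D' * p D₂ D'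
  add_right : ∀ D ∈ H₁, ∀ D₁ ∈ H₂, ∀ D₂ ∈ H₂, p D (D₁ + D₂) = p D D₁ * p D D₂
  equivariant : ∀ σ : GalK K, ∀ D ∈ H₁, ∀ D' ∈ H₂, p (galDiv σ D) (galDiv σ D') = σ (p D D')

end Curve

end

end EllPairing

/-!
The two formulas are compared one point at a time. At a point `P`, the factor of `⟨div f, div g⟩₁`
divided by the factor of `⟨div f, div g⟩₂` is the tame symbol
`(-1) ^ (v_P(f) v_P(g)) (f ^ v_P(g) / g ^ v_P(f))(P)`, in which the uniformizers cancel
(`leadCoeff_zpow_eq_tame_mul`). So the two pairings agree on principal divisors because of Weil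
reciprocity: the product of all tame symbols of two functions is `1` (`tameProd_eq_one`).

Reciprocity is proved from the double cover `x : E → ℙ¹`, with involution `P ↦ -P`.

* If `f = x - x₀` and `g` is regular on the affine curve, with norm `N(g)` in `K̄[x]`, the symbols
  at the points above `x₁` multiply to an expression in `N(g)` near `x₁`, and the product over all
  `x₁` is read off from the factorization of `N(g)`. The only delicate points are infinity and
  those with `P = -P`, where `g` has to be compared with its conjugate `ḡ`: since the involution
  acts as `-1` on the cotangent space, `ḡ / g` takes the value `(-1) ^ v_P(g)` there
  (`IsPlace.hasValue_div_of_involution`).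
* The product of tame symbols is bimultiplicative and satisfies the Steinberg relation, as each
  symbol does. Two regular functions `p₁ + q₁ y` and `p₂ + q₂ y` differ by a polynomial `c` in `x`
  once they are multiplied by `q₂` and `q₁`; dividing by `c` gives two functions `u - w = 1`, so
  the Steinberg relation reduces everything to the case of polynomials in `x`.

The rest rests on each point giving a place of the function field with residue field `K̄`
(`isPlace_ord`). At an affine point this holds because its maximal ideal `𝔪_P` is invertible:
`𝔪_P 𝔪_{-P}` is generated by `x - x_P`. At infinity it holds because the pole orders `2 i` of
`x ^ i` and `2 i + 3` of `x ^ i y` are distinct. Divisors have degree zero because the orders of `a`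
at the points above `x₀` add up to the order of `N(a)` at `x₀` (`sum_fibre_ordReg`), while its pole at
infinity has order `deg N(a)`. A function without zeros and poles is constant (`exists_eq_const`),
and constants cancel against divisors of degree zero, so the pairings are well defined. Galois
equivariance holds since `σ` carries the order and the value of `f` at `P` to those of `σ f` at
`σ P`.
-/

namespace EllPairing

open Polynomial WeierstrassCurve

open scoped Polynomial.Bivariate

/-! ### The order of vanishing along an invertible prime -/

section InvertiblePrime

variable {R : Type*} [CommRing R]

/-- A prime ideal of a domain that divides a nonzero principal ideal, i.e. is invertible as a
fractional ideal. -/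
structure IsInvertiblePrime (P : Ideal R) : Prop where
  isPrime : P.IsPrime
  exists_mul_eq_span : ∃ (Q : Ideal R) (c : R), c ≠ 0 ∧ P * Q = Ideal.span {c}

/-- The largest `n` with `a ∈ P ^ n`; the junk value `0` if there is none. -/
noncomputable def primeOrd (P : Ideal R) (a : R) : ℕ := sSup {n : ℕ | a ∈ P ^ n}

variable {P : Ideal R}

namespace IsInvertiblePrime

variable [IsDomain R]

/-- Powers of `P` cancel in inclusions between ideals. -/
lemma le_of_pow_mul_le (h : IsInvertiblePrime P) {n : ℕ} {I J : Ideal R}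
    (hIJ : P ^ n * I ≤ P ^ n * J) : I ≤ J := by
  obtain ⟨Q, c, hc, hQ⟩ := h.exists_mul_eq_span
  have key : ∀ L : Ideal R, Q ^ n * (P ^ n * L) = Ideal.span {c ^ n} * L := fun L => by
    rw [← mul_assoc, ← mul_pow, mul_comm Q P, hQ, Ideal.span_singleton_pow]
  have := Ideal.mul_mono_right (I := Q ^ n) hIJ
  rw [key, key] at this
  exact (Ideal.span_singleton_mul_right_mono (pow_ne_zero n hc)).mp this

/-- To be contained in a power of `P` is to be divisible by it. -/
lemma exists_eq_pow_mul (h : IsInvertiblePrime P) {n : ℕ} {I : Ideal R} (hI : I ≤ P ^ n) :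
    ∃ J, I = P ^ n * J := by
  obtain ⟨Q, c, hc, hQ⟩ := h.exists_mul_eq_span
  have hPQ : P ^ n * Q ^ n = Ideal.span {c ^ n} := by
    rw [← mul_pow, hQ, Ideal.span_singleton_pow]
  have hle : I * Q ^ n ≤ Ideal.span {c ^ n} := hPQ ▸ Ideal.mul_mono_left hI
  obtain ⟨J, hJ⟩ : ∃ J : Ideal R, I * Q ^ n = Ideal.span {c ^ n} * J := by
    refine ⟨Submodule.comap (LinearMap.mulLeft R (c ^ n)) (I * Q ^ n), le_antisymm ?_ ?_⟩
    · refine Ideal.le_span_singleton_mul_iff.mpr fun z hz => ?_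
      obtain ⟨w, hw⟩ := Ideal.mem_span_singleton'.mp (hle hz)
      have hwz : c ^ n * w = z := by rw [mul_comm, hw]
      exact ⟨w, by simpa [hwz] using hz, hwz⟩
    · exact Ideal.span_singleton_mul_le_iff.mpr fun z hz => by simpa using hz
  refine ⟨J, ?_⟩
  have hcancel : Ideal.span {c ^ n} * I = Ideal.span {c ^ n} * (P ^ n * J) := by
    rw [← hPQ, mul_assoc, mul_comm (Q ^ n) I, hJ, hPQ]
    ring
  exact le_antisymm ((Ideal.span_singleton_mul_right_mono (pow_ne_zero n hc)).mp hcancel.le)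
    ((Ideal.span_singleton_mul_right_mono (pow_ne_zero n hc)).mp hcancel.ge)

variable [IsNoetherianRing R]

lemma mem_pow_iff_le_primeOrd (h : IsInvertiblePrime P) {a : R} (ha : a ≠ 0) {n : ℕ} :
    a ∈ P ^ n ↔ n ≤ primeOrd P a := by
  obtain ⟨N, hN⟩ : ∃ N, a ∉ P ^ N := by
    by_contra! hall
    have hmem : a ∈ ⨅ i, P ^ i := (Submodule.mem_iInf _).mpr hall
    rw [Ideal.iInf_pow_eq_bot_of_isDomain P h.isPrime.ne_top] at hmem
    exact ha hmem
  have hbdd : BddAbove {n : ℕ | a ∈ P ^ n} :=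
    ⟨N, fun n hn => le_of_not_gt fun hlt => hN (Ideal.pow_le_pow_right hlt.le hn)⟩
  refine ⟨fun hn => le_csSup hbdd hn, fun hn => Ideal.pow_le_pow_right hn ?_⟩
  exact Nat.sSup_mem (s := {n : ℕ | a ∈ P ^ n}) ⟨0, by simp⟩ hbdd

lemma primeOrd_eq_of_span_eq (h : IsInvertiblePrime P) {a : R} (ha : a ≠ 0) {n : ℕ}
    {J : Ideal R} (hJ : Ideal.span {a} = P ^ n * J) (hJP : ¬ J ≤ P) : primeOrd P a = n := by
  have hmem : ∀ m, a ∈ P ^ m ↔ Ideal.span {a} ≤ P ^ m := fun m => by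
    rw [Ideal.span_singleton_le_iff_mem]
  refine le_antisymm (le_of_not_gt fun hlt => hJP ?_) ?_
  · have := (hmem _).mp ((h.mem_pow_iff_le_primeOrd ha (n := n + 1)).mpr hlt)
    rw [hJ, pow_succ] at this
    exact h.le_of_pow_mul_le this
  · exact (h.mem_pow_iff_le_primeOrd ha).mp ((hmem _).mpr (hJ ▸ Ideal.mul_le_left))

lemma exists_span_eq_pow_primeOrd_mul (h : IsInvertiblePrime P) {a : R} (ha : a ≠ 0) :
    ∃ J, Ideal.span {a} = P ^ primeOrd P a * J ∧ ¬ J ≤ P := by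
  obtain ⟨J, hJ⟩ := h.exists_eq_pow_mul (n := primeOrd P a) (I := Ideal.span {a})
    ((Ideal.span_singleton_le_iff_mem _).mpr ((h.mem_pow_iff_le_primeOrd ha).mpr le_rfl))
  refine ⟨J, hJ, fun hJP => ?_⟩
  have hle : Ideal.span {a} ≤ P ^ (primeOrd P a + 1) := by
    rw [hJ, pow_succ]
    exact Ideal.mul_mono_right hJP
  exact absurd ((h.mem_pow_iff_le_primeOrd ha).mp ((Ideal.span_singleton_le_iff_mem _).mp hle))
    (by omega)

lemma primeOrd_mul (h : IsInvertiblePrime P) {a b : R} (ha : a ≠ 0) (hb : b ≠ 0) :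
    primeOrd P (a * b) = primeOrd P a + primeOrd P b := by
  obtain ⟨I, hI, hIP⟩ := h.exists_span_eq_pow_primeOrd_mul ha
  obtain ⟨J, hJ, hJP⟩ := h.exists_span_eq_pow_primeOrd_mul hb
  refine h.primeOrd_eq_of_span_eq (mul_ne_zero ha hb) (J := I * J) ?_ fun hle =>
    (h.isPrime.mul_le.mp hle).elim hIP hJP
  rw [← Ideal.span_singleton_mul_span_singleton, hI, hJ, pow_add]
  ring

lemma primeOrd_add (h : IsInvertiblePrime P) {a b : R} (ha : a ≠ 0) (hb : b ≠ 0)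
    (hab : a + b ≠ 0) : min (primeOrd P a) (primeOrd P b) ≤ primeOrd P (a + b) :=
  (h.mem_pow_iff_le_primeOrd hab).mp (add_mem
    ((h.mem_pow_iff_le_primeOrd ha).mpr (min_le_left _ _))
    ((h.mem_pow_iff_le_primeOrd hb).mpr (min_le_right _ _)))

lemma primeOrd_pos_iff (h : IsInvertiblePrime P) {a : R} (ha : a ≠ 0) :
    0 < primeOrd P a ↔ a ∈ P := by
  rw [← Nat.succ_le_iff, ← h.mem_pow_iff_le_primeOrd ha, Nat.succ_eq_one_add, pow_add]
  simp

lemma primeOrd_eq_zero (h : IsInvertiblePrime P) {a : R} (ha : a ∉ P) : primeOrd P a = 0 := by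
  have ha0 : a ≠ 0 := fun h0 => ha (h0 ▸ zero_mem _)
  have := (h.primeOrd_pos_iff ha0).not.mpr ha
  omega

/-- A fraction `a / b` of nonnegative order along `P` has a denominator outside `P`. -/
lemma exists_mul_eq_mul_of_primeOrd_le (h : IsInvertiblePrime P) {a b : R} (ha : a ≠ 0)
    (hb : b ≠ 0) (hab : primeOrd P b ≤ primeOrd P a) : ∃ r s, r ∉ P ∧ r * a = b * s := by
  obtain ⟨J, hJ, hJP⟩ := h.exists_span_eq_pow_primeOrd_mul hb
  obtain ⟨r, hrJ, hrP⟩ := Set.not_subset.mp hJP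
  have hmem : r * a ∈ Ideal.span {b} := by
    rw [hJ, mul_comm r]
    exact Ideal.mul_mem_mul ((h.mem_pow_iff_le_primeOrd ha).mpr hab) hrJ
  obtain ⟨s, hs⟩ := Ideal.mem_span_singleton'.mp hmem
  exact ⟨r, s, hrP, by rw [← hs, mul_comm]⟩

end IsInvertiblePrime

lemma primeOrd_map {S : Type*} [CommRing S] (φ : R ≃+* S) {P : Ideal R} {Q : Ideal S}
    (hPQ : P.map φ = Q) (a : R) : primeOrd Q (φ a) = primeOrd P a := by
  unfold primeOrd
  congr 1
  ext n
  rw [Set.mem_ofPred_eq, Set.mem_ofPred_eq, ← hPQ, ← Ideal.map_pow]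
  exact Ideal.mem_map_of_equiv φ _ |>.trans ⟨fun ⟨x, hx, hxa⟩ => φ.injective hxa ▸ hx,
    fun ha => ⟨a, ha, rfl⟩⟩

end InvertiblePrime

/-! ### Places of a function field and tame symbols -/

section Place

variable {k F : Type*} [Field k] [Field F]

/-- A discrete valuation `v` of a field `F`, trivial on the constants `i : k → F` and with residue
field `k`. The value of `v` at zero is not constrained. -/
structure IsPlace (i : k →+* F) (v : F → ℤ) : Prop where
  mul : ∀ {f g : F}, f ≠ 0 → g ≠ 0 → v (f * g) = v f + v g
  add : ∀ {f g : F}, f ≠ 0 → g ≠ 0 → f + g ≠ 0 → min (v f) (v g) ≤ v (f + g)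
  const : ∀ {c : k}, c ≠ 0 → v (i c) = 0
  exists_value : ∀ {f : F}, f ≠ 0 → 0 ≤ v f → ∃ c, f = i c ∨ 0 < v (f - i c)

/-- The function `f` takes the value `c` at the place `v`. -/
def HasValue (i : k →+* F) (v : F → ℤ) (f : F) (c : k) : Prop := f = i c ∨ 0 < v (f - i c)

/-- The function whose value at the place `v` is the tame symbol of `f` and `g`. -/
def tameFun (v : F → ℤ) (f g : F) : F := (-1) ^ (v f * v g) * (f ^ v g * g ^ (-v f))

lemma neg_one_zpow_mul_self {M : Type*} [DivisionRing M] (n : ℤ) :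
    (-1 : M) ^ (n * n) = (-1) ^ n := by
  rcases Int.even_or_odd n with hn | hn
  · rw [(hn.mul_left n).neg_one_zpow, hn.neg_one_zpow]
  · rw [(hn.mul hn).neg_one_zpow, hn.neg_one_zpow]

namespace IsPlace

variable {i : k →+* F} {v : F → ℤ} {f g : F} {c d : k}

lemma map_one (h : IsPlace i v) : v 1 = 0 := by
  simpa using h.const (c := 1) one_ne_zero

lemma map_neg (h : IsPlace i v) (hf : f ≠ 0) : v (-f) = v f := by
  have h1 : v (i (-1)) = 0 := h.const (neg_ne_zero.mpr one_ne_zero)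
  have := h.mul (f := i (-1)) (g := f) (by simp) hf
  rw [h1] at this
  simpa using this

lemma map_inv (h : IsPlace i v) (hf : f ≠ 0) : v f⁻¹ = -v f := by
  have := h.mul hf (inv_ne_zero hf)
  rw [mul_inv_cancel₀ hf, h.map_one] at this
  omega

lemma map_div (h : IsPlace i v) (hf : f ≠ 0) (hg : g ≠ 0) : v (f / g) = v f - v g := by
  rw [div_eq_mul_inv, h.mul hf (inv_ne_zero hg), h.map_inv hg, sub_eq_add_neg]

lemma map_pow (h : IsPlace i v) (hf : f ≠ 0) (n : ℕ) : v (f ^ n) = n * v f := by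
  induction n with
  | zero => simp [h.map_one]
  | succ n ih => rw [pow_succ, h.mul (pow_ne_zero n hf) hf, ih]; push_cast; ring

lemma map_zpow (h : IsPlace i v) (hf : f ≠ 0) (n : ℤ) : v (f ^ n) = n * v f := by
  obtain ⟨n, rfl | rfl⟩ := n.eq_nat_or_neg
  · simp [h.map_pow hf]
  · rw [zpow_neg, zpow_natCast, h.map_inv (pow_ne_zero n hf), h.map_pow hf]; ring

lemma map_neg_one_zpow (h : IsPlace i v) (n : ℤ) : v ((-1) ^ n) = 0 := by
  rw [h.map_zpow (neg_ne_zero.mpr one_ne_zero), h.map_neg one_ne_zero, h.map_one, mul_zero]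

lemma hasValue_iff : HasValue i v f c ↔ f - i c = 0 ∨ 0 < v (f - i c) := by
  rw [HasValue, sub_eq_zero]

lemma hasValue_const : HasValue i v (i c) c := Or.inl rfl

lemma hasValue_one : HasValue i v 1 1 := Or.inl (i.map_one).symm

lemma hasValue_neg_one_zpow (n : ℤ) : HasValue i v ((-1) ^ n) ((-1) ^ n) := Or.inl (by simp)

lemma hasValue_zero_of_pos (hf : 0 < v f) : HasValue i v f 0 := Or.inr (by simpa using hf)

lemma pos_add (h : IsPlace i v) (hf : f = 0 ∨ 0 < v f) (hg : g = 0 ∨ 0 < v g) :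
    f + g = 0 ∨ 0 < v (f + g) := by
  by_cases hf0 : f = 0
  · simpa [hf0] using hg
  by_cases hg0 : g = 0
  · simpa [hg0] using hf
  by_cases hfg : f + g = 0
  · exact Or.inl hfg
  · exact Or.inr ((lt_min (hf.resolve_left hf0) (hg.resolve_left hg0)).trans_le
      (h.add hf0 hg0 hfg))

lemma nonneg_mul_pos (h : IsPlace i v) (hf : f = 0 ∨ 0 ≤ v f) (hg : g = 0 ∨ 0 < v g) :
    f * g = 0 ∨ 0 < v (f * g) := by
  by_cases hf0 : f = 0
  · simp [hf0]
  by_cases hg0 : g = 0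
  · simp [hg0]
  right
  rw [h.mul hf0 hg0]
  linarith [hf.resolve_left hf0, hg.resolve_left hg0]

lemma hasValue_zero_iff : HasValue i v f 0 ↔ f = 0 ∨ 0 < v f := by
  simp [HasValue]

lemma const_nonneg (h : IsPlace i v) : i c = 0 ∨ 0 ≤ v (i c) := by
  by_cases hc : c = 0
  · simp [hc]
  · exact Or.inr (h.const hc).ge

lemma hasValue_unique (h : IsPlace i v) (hc : HasValue i v f c) (hd : HasValue i v f d) :
    c = d := by
  by_contra hcd
  have hneg : i d - f = 0 ∨ 0 < v (i d - f) := by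
    rcases eq_or_ne (f - i d) 0 with h0 | h0
    · exact Or.inl (by rw [← neg_sub, h0, neg_zero])
    · right
      rw [← neg_sub, h.map_neg h0]
      exact (hasValue_iff.mp hd).resolve_left h0
  have := h.pos_add (hasValue_iff.mp hc) hneg
  rw [show f - i c + (i d - f) = i (d - c) by rw [_root_.map_sub]; ring] at this
  have hdc : d - c ≠ 0 := sub_ne_zero.mpr (Ne.symm hcd)
  rcases this with h0 | hpos
  · exact hdc ((map_eq_zero i).mp h0)
  · exact absurd (h.const hdc) hpos.ne'

lemma nonneg_of_hasValue (h : IsPlace i v) (hc : HasValue i v f c) : f = 0 ∨ 0 ≤ v f := by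
  by_cases hf : f = 0
  · exact Or.inl hf
  right
  rcases hc with rfl | hpos
  · exact (h.const_nonneg).resolve_left hf
  · by_cases hc0 : c = 0
    · simpa [hc0] using hpos.le
    · have hic : i c ≠ 0 := (map_ne_zero i).mpr hc0
      by_cases hfc : f - i c = 0
      · rw [sub_eq_zero.mp hfc, h.const hc0]
      · have := h.add hfc hic (by simpa using hf)
        rw [h.const hc0, sub_add_cancel] at this
        exact (le_min hpos.le le_rfl).trans this

lemma hasValue_mul (h : IsPlace i v) (hc : HasValue i v f c) (hd : HasValue i v g d) :
    HasValue i v (f * g) (c * d) := by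
  rw [hasValue_iff, show f * g - i (c * d) = f * (g - i d) + i d * (f - i c) by
    rw [_root_.map_mul]; ring]
  exact h.pos_add (h.nonneg_mul_pos (h.nonneg_of_hasValue hc) (hasValue_iff.mp hd))
    (h.nonneg_mul_pos h.const_nonneg (hasValue_iff.mp hc))

/-- A unit of the valuation ring has a nonzero value. -/
lemma exists_hasValue (h : IsPlace i v) (hf : f ≠ 0) (hv : v f = 0) :
    ∃ c, c ≠ 0 ∧ HasValue i v f c := by
  obtain ⟨c, hc⟩ := h.exists_value hf hv.ge
  refine ⟨c, ?_, hc⟩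
  rintro rfl
  exact (hasValue_zero_iff.mp hc).elim hf (by omega)

lemma ne_zero_of_hasValue (h : IsPlace i v) (hc : HasValue i v f c) (hc0 : c ≠ 0) : f ≠ 0 := by
  rintro rfl
  exact hc0 (h.hasValue_unique hc (Or.inl (map_zero i).symm))

lemma ord_eq_zero_of_hasValue (h : IsPlace i v) (hc : HasValue i v f c) (hc0 : c ≠ 0) :
    v f = 0 := by
  have hf := h.ne_zero_of_hasValue hc hc0
  refine ((h.nonneg_of_hasValue hc).resolve_left hf).antisymm' (not_lt.mp fun hpos => hc0 ?_)
  exact h.hasValue_unique hc (hasValue_zero_of_pos hpos)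

lemma hasValue_inv (h : IsPlace i v) (hc : HasValue i v f c) (hc0 : c ≠ 0) :
    HasValue i v f⁻¹ c⁻¹ := by
  have hf := h.ne_zero_of_hasValue hc hc0
  obtain ⟨d, -, hd⟩ := h.exists_hasValue (inv_ne_zero hf)
    (by rw [h.map_inv hf, h.ord_eq_zero_of_hasValue hc hc0, neg_zero])
  have := h.hasValue_mul hc hd
  rw [mul_inv_cancel₀ hf] at this
  rwa [inv_eq_of_mul_eq_one_right (h.hasValue_unique this hasValue_one)]

lemma hasValue_pow (h : IsPlace i v) (hc : HasValue i v f c) (n : ℕ) :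
    HasValue i v (f ^ n) (c ^ n) := by
  induction n with
  | zero => simpa using hasValue_one
  | succ n ih => simpa only [pow_succ] using h.hasValue_mul ih hc

lemma hasValue_zpow (h : IsPlace i v) (hc : HasValue i v f c) (hc0 : c ≠ 0) (n : ℤ) :
    HasValue i v (f ^ n) (c ^ n) := by
  obtain ⟨n, rfl | rfl⟩ := n.eq_nat_or_neg
  · simpa using h.hasValue_pow hc n
  · simpa using h.hasValue_inv (h.hasValue_pow hc n) (pow_ne_zero n hc0)

lemma hasValue_div (h : IsPlace i v) (hc : HasValue i v f c) (hd : HasValue i v g d)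
    (hd0 : d ≠ 0) : HasValue i v (f / g) (c / d) := by
  simpa only [div_eq_mul_inv] using h.hasValue_mul hc (h.hasValue_inv hd hd0)

/-! #### Tame symbols -/

lemma tameFun_ne_zero (hf : f ≠ 0) (hg : g ≠ 0) : tameFun v f g ≠ 0 :=
  mul_ne_zero (zpow_ne_zero _ (neg_ne_zero.mpr one_ne_zero))
    (mul_ne_zero (zpow_ne_zero _ hf) (zpow_ne_zero _ hg))

lemma ord_tameFun (h : IsPlace i v) (hf : f ≠ 0) (hg : g ≠ 0) : v (tameFun v f g) = 0 := by
  rw [tameFun, h.mul (zpow_ne_zero _ (neg_ne_zero.mpr one_ne_zero))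
    (mul_ne_zero (zpow_ne_zero _ hf) (zpow_ne_zero _ hg)), h.map_neg_one_zpow,
    h.mul (zpow_ne_zero _ hf) (zpow_ne_zero _ hg), h.map_zpow hf, h.map_zpow hg]
  ring

lemma tameFun_mul_left (h : IsPlace i v) {f₁ f₂ : F} (h₁ : f₁ ≠ 0) (h₂ : f₂ ≠ 0) (hg : g ≠ 0) :
    tameFun v (f₁ * f₂) g = tameFun v f₁ g * tameFun v f₂ g := by
  have h1 : (-1 : F) ≠ 0 := neg_ne_zero.mpr one_ne_zero
  rw [tameFun, tameFun, tameFun, h.mul h₁ h₂, add_mul, zpow_add₀ h1, mul_zpow, neg_add,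
    zpow_add₀ hg]
  ring

lemma tameFun_mul_swap (hf : f ≠ 0) (hg : g ≠ 0) : tameFun v f g * tameFun v g f = 1 := by
  have h1 : (-1 : F) ^ (v f * v g) * (-1) ^ (v f * v g) = 1 := by
    rw [← mul_zpow]; simp
  have h2 : f ^ v g * f ^ (-v g) = 1 := by rw [← zpow_add₀ hf]; simp
  have h3 : g ^ v f * g ^ (-v f) = 1 := by rw [← zpow_add₀ hg]; simp
  rw [tameFun, tameFun, mul_comm (v g)]
  linear_combination (f ^ v g * f ^ (-v g) * (g ^ v f * g ^ (-v f))) * h1 +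
    (g ^ v f * g ^ (-v f)) * h2 + h3

lemma tameFun_neg_self (h : IsPlace i v) (hf : f ≠ 0) : tameFun v f (-f) = 1 := by
  have h1 : (-1 : F) ≠ 0 := neg_ne_zero.mpr one_ne_zero
  have h2 : (-f) ^ (-v f) = (-1) ^ (-v f) * f ^ (-v f) := by rw [← mul_zpow, neg_one_mul]
  rw [tameFun, h.map_neg hf, neg_one_zpow_mul_self, h2,
    mul_left_comm (f ^ v f), ← zpow_add₀ hf, ← mul_assoc, ← zpow_add₀ h1]
  simp

lemma tameFun_eq_one (hf : v f = 0) (hg : v g = 0) : tameFun v f g = 1 := by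
  simp [tameFun, hf, hg]

/-- The Steinberg relation. -/
lemma hasValue_tameFun_of_add_eq_one (h : IsPlace i v) (hf : f ≠ 0) (hg : g ≠ 0)
    (hfg : f + g = 1) : HasValue i v (tameFun v f g) 1 := by
  have aux : ∀ {a b : F}, a ≠ 0 → b ≠ 0 → a + b = 1 → 0 < v a →
      v b = 0 ∧ HasValue i v b 1 := fun {a b} ha hb hab hpos => by
    have hb1 : HasValue i v b 1 := by
      right
      rw [i.map_one, ← hab, sub_add_cancel_right, h.map_neg ha]
      exact hpos
    exact ⟨h.ord_eq_zero_of_hasValue hb1 one_ne_zero, hb1⟩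
  rcases lt_trichotomy (v f) 0 with hneg | hzero | hpos
  · -- both orders agree and are negative, and `f / g = -1 + 1 / g` takes the value `-1`
    have hvg : v g = v f := by
      have e1 := h.add hf hg (by rw [hfg]; exact one_ne_zero)
      have e2 : min (v 1) (v (-f)) ≤ v (1 + -f) :=
        h.add one_ne_zero (neg_ne_zero.mpr hf) (by rwa [← hfg, add_neg_cancel_comm])
      have e3 : min (v 1) (v (-g)) ≤ v (1 + -g) :=
        h.add one_ne_zero (neg_ne_zero.mpr hg) (by rwa [← hfg, add_neg_cancel_right])
      rw [show 1 + -f = g by rw [← hfg]; ring, h.map_neg hf, h.map_one] at e2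
      rw [show 1 + -g = f by rw [← hfg]; ring, h.map_neg hg, h.map_one] at e3
      omega
    have hval : HasValue i v (f / g) (-1) := by
      right
      rw [show f / g - i (-1) = g⁻¹ by
        rw [_root_.map_neg, i.map_one, sub_neg_eq_add, div_add_one hg, hfg, one_div], h.map_inv hg]
      omega
    have := h.hasValue_mul (hasValue_neg_one_zpow (i := i) (v := v) (v f))
      (h.hasValue_zpow hval (neg_ne_zero.mpr one_ne_zero) (v f))
    rw [show (-1 : k) ^ v f * (-1) ^ v f = 1 by rw [← mul_zpow]; simp] at this
    convert this using 1
    rw [tameFun, hvg, neg_one_zpow_mul_self, zpow_neg, div_zpow, div_eq_mul_inv]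
  · rcases eq_or_ne (v g) 0 with hg0 | hg0
    · rw [tameFun_eq_one hzero hg0]
      exact hasValue_one
    · have hgpos : 0 < v g := by
        have e2 : min (v 1) (v (-f)) ≤ v (1 + -f) :=
          h.add one_ne_zero (neg_ne_zero.mpr hf) (by rwa [← hfg, add_neg_cancel_comm])
        rw [show 1 + -f = g by rw [← hfg]; ring, h.map_neg hf, h.map_one] at e2
        omega
      have := h.hasValue_zpow (aux hg hf (by rwa [add_comm]) hgpos).2 one_ne_zero (v g)
      simpa [tameFun, hzero] using this
  · obtain ⟨hg0, hg1⟩ := aux hf hg hfg hpos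
    have := h.hasValue_zpow hg1 one_ne_zero (-v f)
    rw [one_zpow] at this
    simpa [tameFun, hg0] using this

/-- An automorphism that fixes the place and the constants, and acts as `-1` on the cotangent
space, acts by `(-1) ^ n` on leading coefficients of functions of order `n`. -/
lemma hasValue_div_of_involution (h : IsPlace i v) (τ : F ≃+* F) (hτ : ∀ f, f ≠ 0 → v (τ f) = v f)
    (hi : ∀ c, τ (i c) = i c) {t : F} (ht : t ≠ 0) (hvt : v t = 1)
    (htt : HasValue i v (τ t / t) (-1)) (hf : f ≠ 0) :
    HasValue i v (τ f / f) ((-1) ^ v f) := by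
  set u := f * t ^ (-v f) with hu
  have htn : t ^ (-v f) ≠ 0 := zpow_ne_zero _ ht
  have hu0 : u ≠ 0 := mul_ne_zero hf htn
  obtain ⟨c, hc0, hc⟩ := h.exists_hasValue hu0
    (by rw [hu, h.mul hf htn, h.map_zpow ht, hvt]; ring)
  have hcτ : HasValue i v (τ u) c := by
    rw [hasValue_iff]
    rw [hasValue_iff] at hc
    rw [← hi c, ← _root_.map_sub]
    rcases eq_or_ne (u - i c) 0 with h0 | h0
    · exact Or.inl (by rw [h0, _root_.map_zero])
    · exact Or.inr (by rw [hτ _ h0]; exact hc.resolve_left h0)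
  have key := h.hasValue_mul (h.hasValue_div hcτ hc hc0)
    (h.hasValue_zpow htt (neg_ne_zero.mpr one_ne_zero) (v f))
  rw [div_self hc0, one_mul] at key
  convert key using 1
  have hτt : τ t ≠ 0 := (map_ne_zero τ).mpr ht
  rw [hu, _root_.map_mul, map_zpow₀, zpow_neg, zpow_neg, div_zpow]
  field_simp

end IsPlace

end Place

/-! ### The affine coordinate ring -/

section CoordinateRing

open Affine Affine.CoordinateRing

variable {k : Type*} [Field k] (W : WeierstrassCurve.Affine k)

lemma eval₂_polynomial {S : Type*} [CommRing S] (φ : k[X] →+* S) (z : S) :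
    W.polynomial.eval₂ φ z = z ^ 2 + φ (C W.a₁ * X + C W.a₃) * z -
      φ (X ^ 3 + C W.a₂ * X ^ 2 + C W.a₄ * X + C W.a₆) := by
  simp only [Affine.polynomial, eval₂_add, eval₂_sub, eval₂_mul, eval₂_pow, eval₂_X, eval₂_C]

lemma eval₂_negPolynomial :
    W.polynomial.eval₂ ((Algebra.ofId k[X] W.CoordinateRing : k[X] →ₐ[k[X]] W.CoordinateRing) :
      k[X] →+* W.CoordinateRing) (CoordinateRing.mk W W.negPolynomial) = 0 := by
  have h : ∀ p : k[X], ((Algebra.ofId k[X] W.CoordinateRing : k[X] →ₐ[k[X]] W.CoordinateRing) :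
      k[X] →+* W.CoordinateRing) p = CoordinateRing.mk W (C p) := fun p => rfl
  rw [eval₂_polynomial, h, h, ← map_pow, ← map_mul, ← map_add, ← map_sub]
  exact AdjoinRoot.mk_eq_zero.mpr ⟨1, by rw [Affine.polynomial, negPolynomial]; ring⟩

/-- The hyperelliptic involution `(x, y) ↦ (x, -y - a₁x - a₃)` on regular functions. -/
noncomputable def hyperInv : W.CoordinateRing →ₐ[k[X]] W.CoordinateRing :=
  AdjoinRoot.liftAlgHom W.polynomial (Algebra.ofId k[X] W.CoordinateRing)
    (CoordinateRing.mk W W.negPolynomial) (eval₂_negPolynomial W)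

lemma hyperInv_Y : hyperInv W (CoordinateRing.mk W Y) = CoordinateRing.mk W W.negPolynomial :=
  AdjoinRoot.liftAlgHom_root ..

lemma hyperInv_C (p : k[X]) : hyperInv W (CoordinateRing.mk W (C p)) = CoordinateRing.mk W (C p) :=
  (hyperInv W).commutes p

lemma mk_negPolynomial : CoordinateRing.mk W W.negPolynomial =
    -CoordinateRing.mk W Y - CoordinateRing.mk W (C (C W.a₁ * X + C W.a₃)) := by
  simp only [negPolynomial, map_sub, map_neg]

lemma hyperInv_hyperInv (a : W.CoordinateRing) : hyperInv W (hyperInv W a) = a := by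
  obtain ⟨p, q, rfl⟩ := exists_smul_basis_eq a
  simp only [CoordinateRing.smul, mul_one, map_add, map_mul, map_sub, map_neg, hyperInv_C,
    hyperInv_Y, mk_negPolynomial]
  ring

/-- The hyperelliptic involution as an automorphism of the coordinate ring over `k[x]`. -/
noncomputable def hyperEquiv : W.CoordinateRing ≃ₐ[k[X]] W.CoordinateRing :=
  AlgEquiv.ofAlgHom (hyperInv W) (hyperInv W) (AlgHom.ext (hyperInv_hyperInv W))
    (AlgHom.ext (hyperInv_hyperInv W))

lemma hyperEquiv_Y : hyperEquiv W (CoordinateRing.mk W Y) = CoordinateRing.mk W W.negPolynomial :=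
  hyperInv_Y W

lemma hyperEquiv_C (p : k[X]) : hyperEquiv W (CoordinateRing.mk W (C p)) = CoordinateRing.mk W (C p) :=
  hyperInv_C W p

lemma mul_hyperEquiv (a : W.CoordinateRing) :
    a * hyperEquiv W a = CoordinateRing.mk W (C (Algebra.norm k[X] a)) := by
  obtain ⟨p, q, rfl⟩ := exists_smul_basis_eq a
  have h := coe_norm_smul_basis (W' := W) p q
  rw [show CoordinateRing.mk W
    (C (Algebra.norm k[X] (p • (1 : W.CoordinateRing) + q • CoordinateRing.mk W Y))) =
    _ from h]
  simp only [CoordinateRing.smul, mul_one, map_add, map_mul, map_sub, map_neg, hyperEquiv_C,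
    hyperEquiv_Y, mk_negPolynomial]

lemma norm_hyperEquiv (a : W.CoordinateRing) :
    Algebra.norm k[X] (hyperEquiv W a) = Algebra.norm k[X] a :=
  Algebra.norm_eq_of_algEquiv ..

variable {W}

lemma norm_ne_zero {a : W.CoordinateRing} (ha : a ≠ 0) : Algebra.norm k[X] a ≠ 0 := by
  have : Module.Finite k[X] W.CoordinateRing := .of_basis (CoordinateRing.basis W)
  exact Algebra.norm_ne_zero_iff.mpr ha

lemma norm_C (p : k[X]) : Algebra.norm k[X] (CoordinateRing.mk W (C p)) = p ^ 2 := by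
  have := norm_smul_basis (W' := W) p 0
  simpa [CoordinateRing.smul] using this

/-! #### Maximal ideals of points -/

lemma exists_sub_mem_XYIdeal {x y : k} (h : W.Equation x y) (r : W.CoordinateRing) :
    ∃ c : k, r - algebraMap k W.CoordinateRing c ∈ XYIdeal W x (C y) := by
  have h' : (W.polynomial.eval (C y)).eval x = 0 := h
  let e := quotientXYIdealEquiv h'
  refine ⟨e (Ideal.Quotient.mk _ r), ?_⟩
  rw [← Ideal.Quotient.eq]
  apply e.injective
  exact (e.commutes _).symm

lemma XYIdeal_isMaximal {x y : k} (h : W.Equation x y) : (XYIdeal W x (C y)).IsMaximal := by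
  have h' : (W.polynomial.eval (C y)).eval x = 0 := h
  exact Ideal.Quotient.maximal_of_isField _
    ((quotientXYIdealEquiv h').toMulEquiv.isField (Field.toIsField k))

lemma XClass_mem_XYIdeal (x : k) (y : k[X]) : XClass W x ∈ XYIdeal W x y :=
  Ideal.subset_span (by simp)

lemma YClass_mem_XYIdeal (x : k) (y : k[X]) : YClass W y ∈ XYIdeal W x y :=
  Ideal.subset_span (by simp)

lemma algebraMap_eq_mk (c : k) : algebraMap k W.CoordinateRing c = CoordinateRing.mk W (C (C c)) :=
  rfl

lemma algebraMap_mem_XYIdeal {x y c : k} (h : W.Equation x y)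
    (hc : algebraMap k W.CoordinateRing c ∈ XYIdeal W x (C y)) : c = 0 := by
  by_contra hc0
  exact (XYIdeal_isMaximal h).ne_top (Ideal.eq_top_of_isUnit_mem _ hc
    ((IsUnit.mk0 c hc0).map (algebraMap k W.CoordinateRing)))

lemma XYIdeal_injective {x y y' : k} (h : W.Equation x y)
    (hle : XYIdeal W x (C y') ≤ XYIdeal W x (C y)) : y' = y := by
  have h1 := sub_mem (YClass_mem_XYIdeal (W := W) x (C y)) (hle (YClass_mem_XYIdeal x (C y')))
  rw [YClass, YClass, ← map_sub, show (Y - C (C y) - (Y - C (C y')) : k[X][Y]) = C (C (y' - y)) by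
    simp only [C_sub]; ring] at h1
  exact sub_eq_zero.mp (algebraMap_mem_XYIdeal h h1)

lemma XYIdeal_isInvertiblePrime {x y : k} (h : W.Nonsingular x y) :
    IsInvertiblePrime (XYIdeal W x (C y)) where
  isPrime := (XYIdeal_isMaximal h.1).isPrime
  exists_mul_eq_span := ⟨XYIdeal W x (C (W.negY x y)), XClass W x, XClass_ne_zero x, by
    rw [mul_comm]; exact XYIdeal_neg_mul h⟩

lemma map_hyperEquiv_XYIdeal (x y : k) :
    (XYIdeal W x (C y)).map (hyperEquiv W : W.CoordinateRing ≃+* W.CoordinateRing) =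
      XYIdeal W x (C (W.negY x y)) := by
  have hX : ∀ y : k, XClass W x ∈ XYIdeal W x (C y) := fun y => XClass_mem_XYIdeal x _
  have key : ∀ y : k, hyperEquiv W (YClass W (C y)) ∈ XYIdeal W x (C (W.negY x y)) := fun y => by
    have : hyperEquiv W (YClass W (C y)) =
        -YClass W (C (W.negY x y)) - CoordinateRing.mk W (C (C W.a₁)) * XClass W x := by
      simp only [YClass, XClass, map_sub, hyperEquiv_C, hyperEquiv_Y, mk_negPolynomial, negY,
        map_add, map_mul, map_neg]
      ring
    rw [this]
    exact sub_mem (neg_mem (YClass_mem_XYIdeal x _)) (Ideal.mul_mem_left _ _ (hX _))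
  have hle : ∀ y : k, (XYIdeal W x (C y)).map
      (hyperEquiv W : W.CoordinateRing ≃+* W.CoordinateRing) ≤ XYIdeal W x (C (W.negY x y)) := by
    intro y
    rw [XYIdeal, Ideal.map_span, Ideal.span_le]
    rintro _ ⟨a, rfl | rfl, rfl⟩
    · rw [show (hyperEquiv W : W.CoordinateRing ≃+* W.CoordinateRing) (XClass W x) = XClass W x from
        hyperEquiv_C W _]
      exact hX _
    · exact key y
  refine le_antisymm (hle y) fun a ha => ?_
  have h1 := hle (W.negY x y) (Ideal.mem_map_of_mem _ ha)
  rw [negY_negY] at h1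
  have h2 := Ideal.mem_map_of_mem (hyperEquiv W : W.CoordinateRing ≃+* W.CoordinateRing) h1
  rwa [show (hyperEquiv W : W.CoordinateRing ≃+* W.CoordinateRing)
    ((hyperEquiv W : W.CoordinateRing ≃+* W.CoordinateRing) a) = a from
      hyperInv_hyperInv W a] at h2

lemma primeOrd_hyperEquiv (x y : k) (a : W.CoordinateRing) :
    primeOrd (XYIdeal W x (C (W.negY x y))) (hyperEquiv W a) = primeOrd (XYIdeal W x (C y)) a :=
  primeOrd_map (hyperEquiv W : W.CoordinateRing ≃+* W.CoordinateRing)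
    (map_hyperEquiv_XYIdeal x y) a

/-- The function `x - x_P` vanishes to order one at `P` if `P ≠ -P`. -/
lemma primeOrd_XClass_of_ne {x y : k} (h : W.Nonsingular x y) (hy : y ≠ W.negY x y) :
    primeOrd (XYIdeal W x (C y)) (XClass W x) = 1 := by
  refine (XYIdeal_isInvertiblePrime h).primeOrd_eq_of_span_eq (XClass_ne_zero x)
    (J := XYIdeal W x (C (W.negY x y))) ?_ fun hle => hy (XYIdeal_injective h.1 hle).symm
  rw [pow_one, mul_comm]
  exact (XYIdeal_neg_mul h).symm

/-- The function `x - x_P` vanishes to order two at `P` if `P = -P`. -/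
lemma primeOrd_XClass_of_eq {x y : k} (h : W.Nonsingular x y) (hy : y = W.negY x y) :
    primeOrd (XYIdeal W x (C y)) (XClass W x) = 2 := by
  refine (XYIdeal_isInvertiblePrime h).primeOrd_eq_of_span_eq (XClass_ne_zero x) (J := ⊤) ?_
    fun hle => (XYIdeal_isMaximal h.1).ne_top (top_le_iff.mp hle)
  have := XYIdeal_neg_mul h
  rw [← hy] at this
  rw [Ideal.mul_top, pow_two, this, XIdeal]

lemma mk_C_sub_eval_mem (p : k[X]) (x : k) (y : k[X]) :
    CoordinateRing.mk W (C p) - algebraMap k W.CoordinateRing (p.eval x) ∈ XYIdeal W x y := by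
  obtain ⟨q, hq⟩ := X_sub_C_dvd_sub_C_eval (a := x) (p := p)
  have : CoordinateRing.mk W (C p) - algebraMap k W.CoordinateRing (p.eval x) =
      CoordinateRing.mk W (C q) * XClass W x := by
    rw [algebraMap_eq_mk, ← map_sub, ← C_sub, hq, XClass, ← map_mul, ← C_mul, mul_comm]
  rw [this]
  exact Ideal.mul_mem_left _ _ (XClass_mem_XYIdeal x y)

lemma mk_C_ne_zero {p : k[X]} (hp : p ≠ 0) : CoordinateRing.mk W (C p) ≠ 0 := fun h0 => by
  have := norm_C (W := W) p
  rw [h0] at this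
  have hz : Algebra.norm k[X] (0 : W.CoordinateRing) = 0 := by
    simpa using norm_smul_basis (W' := W) 0 0
  rw [hz] at this
  exact pow_ne_zero 2 hp this.symm

lemma primeOrd_pow {R : Type*} [CommRing R] [IsDomain R] [IsNoetherianRing R] {P : Ideal R}
    (h : IsInvertiblePrime P) {a : R} (ha : a ≠ 0) (n : ℕ) :
    primeOrd P (a ^ n) = n * primeOrd P a := by
  induction n with
  | zero =>
    rw [pow_zero, zero_mul]
    exact h.primeOrd_eq_zero ((Ideal.ne_top_iff_one P).mp h.isPrime.ne_top)
  | succ n ih => rw [pow_succ, h.primeOrd_mul (pow_ne_zero n ha) ha, ih]; ring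

/-- A polynomial in `x` vanishes at `P` to its order at `x_P` times that of `x - x_P`. -/
lemma primeOrd_mk_C {x y : k} (h : W.Nonsingular x y) {p : k[X]} (hp : p ≠ 0) :
    primeOrd (XYIdeal W x (C y)) (CoordinateRing.mk W (C p)) =
      p.rootMultiplicity x * primeOrd (XYIdeal W x (C y)) (XClass W x) := by
  have hP := XYIdeal_isInvertiblePrime h
  obtain ⟨m, hm, hdvd⟩ := exists_eq_pow_rootMultiplicity_mul_and_not_dvd p hp x
  have hm0 : m ≠ 0 := fun h0 => hdvd (h0 ▸ dvd_zero _)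
  have hmP : CoordinateRing.mk W (C m) ∉ XYIdeal W x (C y) := fun hmem => by
    have := sub_mem hmem (mk_C_sub_eval_mem (W := W) m x (C y))
    rw [sub_sub_cancel] at this
    exact hdvd (dvd_iff_isRoot.mpr (algebraMap_mem_XYIdeal h.1 this))
  conv_lhs => rw [hm]
  rw [C_mul, map_mul, C_pow, map_pow, ← XClass, hP.primeOrd_mul
    (pow_ne_zero _ (XClass_ne_zero x)) (mk_C_ne_zero hm0), hP.primeOrd_eq_zero hmP, add_zero]
  exact primeOrd_pow hP (XClass_ne_zero x) _

/-- The orders of a function at the two points above `x` add up to the order of its norm. -/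
lemma primeOrd_add_primeOrd_neg {x y : k} (h : W.Nonsingular x y) (hy : y ≠ W.negY x y)
    {a : W.CoordinateRing} (ha : a ≠ 0) :
    primeOrd (XYIdeal W x (C y)) a + primeOrd (XYIdeal W x (C (W.negY x y))) a =
      (Algebra.norm k[X] a).rootMultiplicity x := by
  have hP := XYIdeal_isInvertiblePrime h
  have hι : hyperEquiv W a ≠ 0 := (map_ne_zero_iff _ (hyperEquiv W).injective).mpr ha
  have h1 := primeOrd_mk_C h (norm_ne_zero ha)
  rw [primeOrd_XClass_of_ne h hy, mul_one, ← mul_hyperEquiv, hP.primeOrd_mul ha hι] at h1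
  rw [← h1]
  have h2 := primeOrd_hyperEquiv (W := W) x (W.negY x y) a
  rw [negY_negY] at h2
  rw [h2]

/-- At a point `P = -P`, the order of a function is the order of its norm at `x_P`. -/
lemma primeOrd_eq_rootMultiplicity_norm {x y : k} (h : W.Nonsingular x y) (hy : y = W.negY x y)
    {a : W.CoordinateRing} (ha : a ≠ 0) :
    primeOrd (XYIdeal W x (C y)) a = (Algebra.norm k[X] a).rootMultiplicity x := by
  have hP := XYIdeal_isInvertiblePrime h
  have hι : hyperEquiv W a ≠ 0 := (map_ne_zero_iff _ (hyperEquiv W).injective).mpr ha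
  have h1 := primeOrd_mk_C h (norm_ne_zero ha)
  rw [primeOrd_XClass_of_eq h hy, ← mul_hyperEquiv, hP.primeOrd_mul ha hι] at h1
  have h2 := primeOrd_hyperEquiv (W := W) x y a
  rw [← hy] at h2
  omega

/-- At a point `P = -P`, the function `y - y_P` is a uniformizer. -/
lemma primeOrd_YClass_of_eq {x y : k} (h : W.Nonsingular x y) (hy : y = W.negY x y) :
    primeOrd (XYIdeal W x (C y)) (YClass W (C y)) = 1 := by
  have hP := XYIdeal_isInvertiblePrime h
  have hpos := (hP.primeOrd_pos_iff (YClass_ne_zero (W' := W) (C y))).mpr (YClass_mem_XYIdeal x _)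
  refine le_antisymm (le_of_not_gt fun hlt => ?_) hpos
  have hY2 := (hP.mem_pow_iff_le_primeOrd (YClass_ne_zero (W' := W) (C y)) (n := 2)).mpr hlt
  have hX2 := (hP.mem_pow_iff_le_primeOrd (XClass_ne_zero (W' := W) x) (n := 2)).mpr
    (primeOrd_XClass_of_eq h hy).ge
  have hle : XYIdeal W x (C y) ^ 1 * ⊤ ≤ XYIdeal W x (C y) ^ 1 * XYIdeal W x (C y) := by
    rw [Ideal.mul_top, ← pow_succ, pow_one]
    conv_lhs => rw [XYIdeal]
    rw [Ideal.span_le]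
    rintro a (rfl | rfl)
    exacts [hX2, hY2]
  exact hP.isPrime.ne_top (top_le_iff.mp (hP.le_of_pow_mul_le hle))

/-! #### The degree of the norm -/

lemma natDegree_norm_mul {a b : W.CoordinateRing} (ha : a ≠ 0) (hb : b ≠ 0) :
    (Algebra.norm k[X] (a * b)).natDegree =
      (Algebra.norm k[X] a).natDegree + (Algebra.norm k[X] b).natDegree := by
  rw [map_mul, natDegree_mul (norm_ne_zero ha) (norm_ne_zero hb)]

lemma degree_norm_add_le (a b : W.CoordinateRing) :
    (Algebra.norm k[X] (a + b)).degree ≤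
      max (Algebra.norm k[X] a).degree (Algebra.norm k[X] b).degree := by
  obtain ⟨p, q, rfl⟩ := exists_smul_basis_eq a
  obtain ⟨r, s, rfl⟩ := exists_smul_basis_eq b
  have : p • (1 : W.CoordinateRing) + q • CoordinateRing.mk W Y +
      (r • (1 : W.CoordinateRing) + s • CoordinateRing.mk W Y) =
      (p + r) • (1 : W.CoordinateRing) + (q + s) • CoordinateRing.mk W Y := by
    simp only [add_smul]; ring
  rw [this, degree_norm_smul_basis, degree_norm_smul_basis, degree_norm_smul_basis]
  have h2 : ∀ {m n : WithBot ℕ}, m ≤ n → 2 • m ≤ 2 • n := fun h => nsmul_le_nsmul_right h 2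
  have h1 := degree_add_le p r
  have h3 := degree_add_le q s
  refine max_le ?_ ?_
  · rcases le_max_iff.mp h1 with h | h
    · exact (h2 h).trans ((le_max_left _ _).trans (le_max_left _ _))
    · exact (h2 h).trans ((le_max_left _ _).trans (le_max_right _ _))
  · rcases le_max_iff.mp h3 with h | h
    · exact (add_le_add_left (h2 h) 3).trans ((le_max_right _ _).trans (le_max_left _ _))
    · exact (add_le_add_left (h2 h) 3).trans ((le_max_right _ _).trans (le_max_right _ _))

lemma degree_norm_lt_iff (p q : k[X]) (m : ℕ) :
    (Algebra.norm k[X] (p • (1 : W.CoordinateRing) + q • CoordinateRing.mk W Y)).degree < m ↔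
      (∀ i, m ≤ 2 * i → p.coeff i = 0) ∧ ∀ i, m ≤ 2 * i + 3 → q.coeff i = 0 := by
  have key : ∀ (r : k[X]) (n : ℕ), 2 • r.degree + n < m ↔ ∀ i, m ≤ 2 * i + n → r.coeff i = 0 := by
    intro r n
    by_cases hr : r = 0
    · simp [hr]
    rw [degree_eq_natDegree hr, nsmul_eq_mul]
    have hcast : ((2 : ℕ) : WithBot ℕ) * r.natDegree + n < m ↔ 2 * r.natDegree + n < m := by
      norm_cast
    rw [hcast]
    refine ⟨fun h i hi => coeff_eq_zero_of_natDegree_lt (by omega), fun h => ?_⟩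
    by_contra! hle
    exact hr (leadingCoeff_eq_zero.mp (h _ hle))
  have h0 := key p 0
  have h3 := key q 3
  simp only [Nat.cast_zero, add_zero] at h0
  rw [degree_norm_smul_basis, max_lt_iff, h0, ← h3]
  rfl

/-- Pole orders at infinity: subtracting a constant multiple of `b` from `a` cancels the leading
term, since the orders `2 i` of `x ^ i` and `2 i + 3` of `x ^ i y` are all distinct. -/
lemma exists_degree_norm_sub_lt {a b : W.CoordinateRing} (hb : b ≠ 0)
    (hab : (Algebra.norm k[X] a).natDegree ≤ (Algebra.norm k[X] b).natDegree) :
    ∃ c : k, (Algebra.norm k[X] (a - algebraMap k _ c * b)).degree <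
      (Algebra.norm k[X] b).natDegree := by
  obtain ⟨p, q, rfl⟩ := exists_smul_basis_eq a
  obtain ⟨r, s, rfl⟩ := exists_smul_basis_eq b
  set N := Algebra.norm k[X] (r • (1 : W.CoordinateRing) + s • CoordinateRing.mk W Y) with hN
  set m := N.natDegree with hm
  have hlt : ∀ t : k[X], t.natDegree ≤ m → t.degree < (m + 1 : ℕ) := fun t ht =>
    (degree_le_natDegree.trans (Nat.cast_le.mpr ht)).trans_lt (Nat.cast_lt.mpr m.lt_succ_self)
  have hpq := (degree_norm_lt_iff p q (m + 1)).mp (hlt _ hab)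
  have hrs := (degree_norm_lt_iff r s (m + 1)).mp (hlt _ le_rfl)
  have hnot : ¬ N.degree < m := by
    rw [degree_eq_natDegree (norm_ne_zero hb)]
    exact lt_irrefl _
  have hsub : ∀ c : k, p • (1 : W.CoordinateRing) + q • CoordinateRing.mk W Y -
      algebraMap k _ c * (r • (1 : W.CoordinateRing) + s • CoordinateRing.mk W Y) =
        (p - C c * r) • (1 : W.CoordinateRing) + (q - C c * s) • CoordinateRing.mk W Y := by
    intro c
    simp only [CoordinateRing.smul, algebraMap_eq_mk, map_sub, map_mul]
    ring
  simp only [hsub, degree_norm_lt_iff]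
  rw [hN, degree_norm_lt_iff, not_and_or] at hnot
  push Not at hnot
  rcases hnot with ⟨i, hi, hri⟩ | ⟨i, hi, hsi⟩
  · have hmi : m = 2 * i := by
      by_contra hne
      exact hri (hrs.1 i (by omega))
    refine ⟨p.coeff i / r.coeff i, fun j hj => ?_, fun j hj => ?_⟩
    · rcases eq_or_ne j i with rfl | hji
      · simp [hri]
      · simp [hpq.1 j (by omega), hrs.1 j (by omega)]
    · simp [hpq.2 j (by omega), hrs.2 j (by omega)]
  · have hmi : m = 2 * i + 3 := by
      by_contra hne
      exact hsi (hrs.2 i (by omega))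
    refine ⟨q.coeff i / s.coeff i, fun j hj => ?_, fun j hj => ?_⟩
    · simp [hpq.1 j (by omega), hrs.1 j (by omega)]
    · rcases eq_or_ne j i with rfl | hji
      · simp [hsi]
      · simp [hpq.2 j (by omega), hrs.2 j (by omega)]

lemma exists_eq_algebraMap_of_natDegree_norm_eq_zero {a : W.CoordinateRing}
    (ha : (Algebra.norm k[X] a).natDegree = 0) : ∃ c : k, a = algebraMap k _ c := by
  obtain ⟨p, q, rfl⟩ := exists_smul_basis_eq a
  have hpq := (degree_norm_lt_iff (W := W) p q 1).mp
    (degree_le_natDegree.trans_lt (by rw [ha]; exact Nat.cast_lt.mpr one_pos))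
  refine ⟨p.coeff 0, ?_⟩
  have hq : q = 0 := ext fun i => by simpa using hpq.2 i (by omega)
  have hp : p = C (p.coeff 0) := ext fun i => by
    rcases eq_or_ne i 0 with rfl | hi
    · simp
    · rw [hpq.1 i (by omega), coeff_C_of_ne_zero hi]
  rw [hq, zero_smul, add_zero, CoordinateRing.smul, mul_one, algebraMap_eq_mk, ← hp]

end CoordinateRing

/-! ### Orders and values at the points of an elliptic curve -/

section Points

open Affine Affine.CoordinateRing

variable {K : Type*} [Field K] {W : WeierstrassCurve K}

instance [W.IsElliptic] : (Ebar W).IsElliptic :=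
  inferInstanceAs (W.map (algebraMap K (AlgebraicClosure K))).IsElliptic

lemma ordReg_zero (a : CoordRing W) :
    ordReg (0 : Pt W) a = -((Algebra.norm (AlgebraicClosure K)[X] a).natDegree : ℤ) := rfl

lemma ordReg_some {x y : AlgebraicClosure K} (h : (Ebar W).Nonsingular x y) (a : CoordRing W) :
    ordReg (Affine.Point.some x y h) a = primeOrd (XYIdeal (Ebar W) x (C y)) a := rfl

lemma const_apply (c : AlgebraicClosure K) :
    const W c = algebraMap (CoordRing W) (FunField W) (algebraMap _ _ c) := rfl

lemma ordReg_mul (P : Pt W) {a b : CoordRing W} (ha : a ≠ 0) (hb : b ≠ 0) :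
    ordReg P (a * b) = ordReg P a + ordReg P b := by
  rcases P with _ | ⟨x, y, h⟩
  · change ordReg 0 _ = ordReg 0 _ + ordReg 0 _
    rw [ordReg_zero, ordReg_zero, ordReg_zero, natDegree_norm_mul ha hb]
    push_cast; ring
  · rw [ordReg_some, ordReg_some, ordReg_some, (XYIdeal_isInvertiblePrime h).primeOrd_mul ha hb]
    push_cast; ring

lemma ordReg_add (P : Pt W) {a b : CoordRing W} (ha : a ≠ 0) (hb : b ≠ 0) (hab : a + b ≠ 0) :
    min (ordReg P a) (ordReg P b) ≤ ordReg P (a + b) := by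
  rcases P with _ | ⟨x, y, h⟩
  · change min (ordReg 0 _) (ordReg 0 _) ≤ ordReg 0 _
    rw [ordReg_zero, ordReg_zero, ordReg_zero]
    have := degree_norm_add_le a b
    rw [degree_eq_natDegree (norm_ne_zero ha), degree_eq_natDegree (norm_ne_zero hb),
      degree_eq_natDegree (norm_ne_zero hab), le_max_iff, Nat.cast_le, Nat.cast_le] at this
    omega
  · rw [ordReg_some, ordReg_some, ordReg_some]
    exact_mod_cast (XYIdeal_isInvertiblePrime h).primeOrd_add ha hb hab

lemma ordReg_algebraMap (P : Pt W) {c : AlgebraicClosure K} (hc : c ≠ 0) :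
    ordReg P (algebraMap _ (CoordRing W) c) = 0 := by
  rcases P with _ | ⟨x, y, h⟩
  · change ordReg 0 _ = 0
    rw [ordReg_zero, algebraMap_eq_mk, norm_C, natDegree_pow, natDegree_C]
    rfl
  · rw [ordReg_some, (XYIdeal_isInvertiblePrime h).primeOrd_eq_zero]
    · rfl
    · exact fun hmem => hc (algebraMap_mem_XYIdeal h.1 hmem)

lemma algebraMap_ne_zero {a : CoordRing W} (ha : a ≠ 0) :
    algebraMap (CoordRing W) (FunField W) a ≠ 0 :=
  (map_ne_zero_iff _ (IsFractionRing.injective _ _)).mpr ha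

/-- The order of a fraction does not depend on how it is written. -/
lemma ord_eq_of_mul_eq (P : Pt W) {f : FunField W} {a b : CoordRing W} (ha : a ≠ 0) (hb : b ≠ 0)
    (h : f * algebraMap _ _ b = algebraMap _ _ a) : ord P f = ordReg P a - ordReg P b := by
  have hsec := IsLocalization.sec_spec (nonZeroDivisors (CoordRing W)) f
  unfold ord
  set s := IsLocalization.sec (nonZeroDivisors (CoordRing W)) f with hs
  have hs2 : (s.2 : CoordRing W) ≠ 0 := nonZeroDivisors.ne_zero s.2.2
  have hf : f ≠ 0 := by
    rintro rfl
    rw [zero_mul] at h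
    exact algebraMap_ne_zero ha h.symm
  have hs1 : s.1 ≠ 0 := by
    intro h0
    rw [h0, map_zero] at hsec
    exact mul_ne_zero hf (algebraMap_ne_zero hs2) hsec
  have key : s.1 * b = a * s.2 := by
    apply IsFractionRing.injective (CoordRing W) (FunField W)
    rw [map_mul, map_mul, ← hsec, ← h]
    ring
  have := congrArg (ordReg P) key
  rw [ordReg_mul P hs1 hb, ordReg_mul P ha hs2] at this
  linarith

lemma exists_mul_eq {f : FunField W} (hf : f ≠ 0) : ∃ a b : CoordRing W, a ≠ 0 ∧ b ≠ 0 ∧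
    f * algebraMap _ _ b = algebraMap _ _ a := by
  have hsec := IsLocalization.sec_spec (nonZeroDivisors (CoordRing W)) f
  set s := IsLocalization.sec (nonZeroDivisors (CoordRing W)) f with hs
  have hs2 : (s.2 : CoordRing W) ≠ 0 := nonZeroDivisors.ne_zero s.2.2
  refine ⟨s.1, s.2, fun h0 => ?_, hs2, hsec⟩
  rw [h0, map_zero] at hsec
  exact mul_ne_zero hf (algebraMap_ne_zero hs2) hsec

lemma ord_algebraMap (P : Pt W) {a : CoordRing W} (ha : a ≠ 0) :
    ord P (algebraMap _ _ a) = ordReg P a := by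
  rw [ord_eq_of_mul_eq P ha one_ne_zero (by rw [map_one, mul_one]),
    ← map_one (algebraMap (AlgebraicClosure K) (CoordRing W)), ordReg_algebraMap P one_ne_zero,
    sub_zero]

/-- The residue field at every point is the field of constants. -/
lemma exists_value_of_ord_nonneg (P : Pt W) {f : FunField W} (hf : f ≠ 0) (hv : 0 ≤ ord P f) :
    ∃ c, f = const W c ∨ 0 < ord P (f - const W c) := by
  obtain ⟨a, b, ha, hb, hab⟩ := exists_mul_eq hf
  rw [ord_eq_of_mul_eq P ha hb hab] at hv
  -- for a fraction `f = s / r`, compare `s` with a constant multiple of `r`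
  have main : ∀ {r s : CoordRing W} (c : AlgebraicClosure K), r ≠ 0 →
      f * algebraMap _ _ r = algebraMap _ _ s →
      (s - algebraMap _ _ c * r ≠ 0 → ordReg P r < ordReg P (s - algebraMap _ _ c * r)) →
      f = const W c ∨ 0 < ord P (f - const W c) := by
    intro r s c hr hrs hlt
    have hsub : (f - const W c) * algebraMap _ _ r =
        algebraMap _ _ (s - algebraMap _ _ c * r) := by
      rw [sub_mul, hrs, map_sub, map_mul, const_apply]
    by_cases h0 : s - algebraMap _ _ c * r = 0
    · left
      rw [h0, map_zero] at hsub
      exact sub_eq_zero.mp ((mul_eq_zero.mp hsub).resolve_right (algebraMap_ne_zero hr))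
    · right
      rw [ord_eq_of_mul_eq P h0 hr hsub]
      linarith [hlt h0]
  rcases P with _ | ⟨x, y, h⟩
  · change 0 ≤ ordReg 0 _ - ordReg 0 _ at hv
    rw [ordReg_zero, ordReg_zero] at hv
    obtain ⟨c, hc⟩ := exists_degree_norm_sub_lt (a := a) hb (by omega)
    refine ⟨c, main c hb hab fun h0 => ?_⟩
    change ordReg 0 _ < ordReg 0 _
    rw [degree_eq_natDegree (norm_ne_zero h0), Nat.cast_lt] at hc
    rw [ordReg_zero, ordReg_zero]
    omega
  · have hP := XYIdeal_isInvertiblePrime h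
    rw [ordReg_some, ordReg_some] at hv
    obtain ⟨r, s, hr, hrs⟩ := hP.exists_mul_eq_mul_of_primeOrd_le ha hb (by omega)
    obtain ⟨cr, hcr⟩ := exists_sub_mem_XYIdeal h.1 r
    obtain ⟨cs, hcs⟩ := exists_sub_mem_XYIdeal h.1 s
    have hr0 : r ≠ 0 := fun h0 => hr (h0 ▸ zero_mem _)
    have hcr0 : cr ≠ 0 := by
      rintro rfl
      rw [map_zero, sub_zero] at hcr
      exact hr hcr
    refine ⟨cs / cr, main (s := s) (cs / cr) hr0 ?_ fun h0 => ?_⟩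
    · apply mul_right_cancel₀ (algebraMap_ne_zero hb)
      rw [mul_right_comm, hab, ← map_mul, ← map_mul, mul_comm a, hrs, mul_comm]
    · rw [ordReg_some, ordReg_some, hP.primeOrd_eq_zero hr]
      refine Nat.cast_lt.mpr ((hP.primeOrd_pos_iff h0).mpr ?_)
      have e : s - algebraMap _ _ (cs / cr) * r = (s - algebraMap _ _ cs) -
          algebraMap _ _ (cs / cr) * (r - algebraMap _ _ cr) := by
        rw [mul_sub, ← map_mul, div_mul_cancel₀ _ hcr0]
        ring
      rw [e]
      exact sub_mem hcs (Ideal.mul_mem_left _ _ hcr)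

/-- Every point of the curve defines a place of the function field. -/
lemma isPlace_ord (P : Pt W) : IsPlace (const W) (ord P) where
  mul {f g} hf hg := by
    obtain ⟨a, b, ha, hb, hab⟩ := exists_mul_eq hf
    obtain ⟨c, d, hc, hd, hcd⟩ := exists_mul_eq hg
    rw [ord_eq_of_mul_eq P ha hb hab, ord_eq_of_mul_eq P hc hd hcd,
      ord_eq_of_mul_eq P (mul_ne_zero ha hc) (mul_ne_zero hb hd)
        (by rw [map_mul, map_mul, ← hab, ← hcd]; ring),
      ordReg_mul P ha hc, ordReg_mul P hb hd]
    ring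
  add {f g} hf hg hfg := by
    obtain ⟨a, b, ha, hb, hab⟩ := exists_mul_eq hf
    obtain ⟨c, d, hc, hd, hcd⟩ := exists_mul_eq hg
    have hsum : (f + g) * algebraMap _ _ (b * d) = algebraMap _ _ (a * d + c * b) := by
      rw [map_mul, map_add, map_mul, map_mul, ← hab, ← hcd]; ring
    have h0 : a * d + c * b ≠ 0 := by
      intro h0
      rw [h0, map_zero] at hsum
      exact mul_ne_zero hfg (algebraMap_ne_zero (mul_ne_zero hb hd)) hsum
    have := ordReg_add P (mul_ne_zero ha hd) (mul_ne_zero hc hb) h0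
    rw [ordReg_mul P ha hd, ordReg_mul P hc hb] at this
    rw [ord_eq_of_mul_eq P ha hb hab, ord_eq_of_mul_eq P hc hd hcd,
      ord_eq_of_mul_eq P h0 (mul_ne_zero hb hd) hsum, ordReg_mul P hb hd]
    omega
  const {c} hc := by
    rw [const_apply, ord_algebraMap P ((map_ne_zero_iff _
      (FaithfulSMul.algebraMap_injective _ _)).mpr hc), ordReg_algebraMap P hc]
  exists_value hf hv := exists_value_of_ord_nonneg P hf hv

lemma value_eq {P : Pt W} {f : FunField W} {c : AlgebraicClosure K}
    (h : HasValue (const W) (ord P) f c) : value P f = c := by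
  have hex : ∃ c : AlgebraicClosure K, f = const W c ∨ 0 < ord P (f - const W c) := ⟨c, h⟩
  rw [value, dif_pos hex]
  exact (isPlace_ord P).hasValue_unique hex.choose_spec h

lemma hasValue_value {P : Pt W} {f : FunField W} (hf : f ≠ 0) (hv : ord P f = 0) :
    HasValue (const W) (ord P) f (value P f) := by
  obtain ⟨c, -, hc⟩ := (isPlace_ord P).exists_hasValue hf hv
  rwa [value_eq hc]

lemma value_ne_zero {P : Pt W} {f : FunField W} (hf : f ≠ 0) (hv : ord P f = 0) :
    value P f ≠ 0 := by
  obtain ⟨c, hc0, hc⟩ := (isPlace_ord P).exists_hasValue hf hv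
  rwa [value_eq hc]

lemma value_mul {P : Pt W} {f g : FunField W} (hf : f ≠ 0) (hg : g ≠ 0) (hvf : ord P f = 0)
    (hvg : ord P g = 0) : value P (f * g) = value P f * value P g :=
  value_eq ((isPlace_ord P).hasValue_mul (hasValue_value hf hvf) (hasValue_value hg hvg))

lemma value_one (P : Pt W) : value P (1 : FunField W) = 1 :=
  value_eq IsPlace.hasValue_one

/-! #### Automorphisms -/

lemma ord_ringEquiv (φ : CoordRing W ≃+* CoordRing W) {P Q : Pt W}
    (h : ∀ a, a ≠ 0 → ordReg Q (φ a) = ordReg P a) {f : FunField W} (hf : f ≠ 0) :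
    ord Q (IsFractionRing.ringEquivOfRingEquiv φ f : FunField W) = ord P f := by
  obtain ⟨a, b, ha, hb, hab⟩ := exists_mul_eq hf
  have hφ : ∀ {c}, c ≠ 0 → φ c ≠ 0 := fun hc => (map_ne_zero_iff _ φ.injective).mpr hc
  rw [ord_eq_of_mul_eq P ha hb hab, ord_eq_of_mul_eq Q (hφ ha) (hφ hb), h a ha, h b hb]
  rw [← IsFractionRing.ringEquivOfRingEquiv_algebraMap (K := FunField W) (L := FunField W) φ b,
    ← IsFractionRing.ringEquivOfRingEquiv_algebraMap (K := FunField W) (L := FunField W) φ a,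
    ← map_mul, hab]

lemma hasValue_ringEquiv (φ : FunField W ≃+* FunField W)
    (τ : AlgebraicClosure K ≃+* AlgebraicClosure K) (hτ : ∀ c, φ (const W c) = const W (τ c))
    {P Q : Pt W} (h : ∀ f, f ≠ 0 → ord Q (φ f) = ord P f) {f : FunField W}
    {c : AlgebraicClosure K} (hc : HasValue (const W) (ord P) f c) :
    HasValue (const W) (ord Q) (φ f) (τ c) := by
  rw [IsPlace.hasValue_iff] at hc ⊢
  rw [← hτ, ← map_sub]
  rcases eq_or_ne (f - const W c) 0 with h0 | h0
  · exact Or.inl (by rw [h0, map_zero])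
  · exact Or.inr (by rw [h _ h0]; exact hc.resolve_left h0)

end Points

/-! ### Galois action and hyperelliptic involution -/

section Automorphisms

open Affine Affine.CoordinateRing

variable {K : Type*} [Field K] {W : WeierstrassCurve K}

lemma galCoord_C (σ : GalK K) (p : (AlgebraicClosure K)[X]) :
    galCoord W σ (CoordinateRing.mk (Ebar W) (C p)) =
      CoordinateRing.mk (Ebar W) (C (p.map (σ : AlgebraicClosure K →+* AlgebraicClosure K))) :=
  AdjoinRoot.map_of _ _ _ (Associated.of_eq (map_polynomial_eq W σ)).symm.dvd p

lemma galCoord_Y (σ : GalK K) :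
    galCoord W σ (CoordinateRing.mk (Ebar W) Y) = CoordinateRing.mk (Ebar W) Y :=
  AdjoinRoot.map_root _ _ _ (Associated.of_eq (map_polynomial_eq W σ)).symm.dvd

lemma galPt_some (σ : GalK K) {x y : AlgebraicClosure K} (h : (Ebar W).Nonsingular x y) :
    ∃ h', galPt σ (Affine.Point.some x y h) = Affine.Point.some (σ x) (σ y) h' :=
  ⟨_, rfl⟩

lemma galPt_injective (σ : GalK K) : Function.Injective (galPt (W := W) σ) := by
  classical
  intro P Q h
  apply Affine.Point.map_injective (W' := W) (σ : AlgebraicClosure K →ₐ[K] AlgebraicClosure K)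
  exact h

lemma galCoord_XClass (σ : GalK K) (x : AlgebraicClosure K) :
    galCoord W σ (XClass (Ebar W) x) = XClass (Ebar W) (σ x) := by
  rw [XClass, XClass, galCoord_C]
  simp

lemma galCoord_YClass (σ : GalK K) (y : AlgebraicClosure K) :
    galCoord W σ (YClass (Ebar W) (C y)) = YClass (Ebar W) (C (σ y)) := by
  rw [YClass, YClass, map_sub, map_sub, map_sub, galCoord_C, galCoord_Y]
  simp

lemma map_galCoord_XYIdeal (σ : GalK K) (x y : AlgebraicClosure K) :
    (XYIdeal (Ebar W) x (C y)).map (galCoord W σ) = XYIdeal (Ebar W) (σ x) (C (σ y)) := by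
  rw [XYIdeal, Ideal.map_span, Set.image_pair, XYIdeal, galCoord_XClass, galCoord_YClass]

lemma natDegree_norm_galCoord (σ : GalK K) (a : CoordRing W) :
    (Algebra.norm (AlgebraicClosure K)[X] (galCoord W σ a)).natDegree =
      (Algebra.norm (AlgebraicClosure K)[X] a).natDegree := by
  obtain ⟨p, q, rfl⟩ := exists_smul_basis_eq a
  have : galCoord W σ (p • (1 : CoordRing W) + q • CoordinateRing.mk (Ebar W) Y) =
      p.map (σ : AlgebraicClosure K →+* AlgebraicClosure K) • (1 : CoordRing W) +
        q.map (σ : AlgebraicClosure K →+* AlgebraicClosure K) • CoordinateRing.mk (Ebar W) Y := by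
    simp only [CoordinateRing.smul, mul_one, map_add, map_mul, galCoord_C, galCoord_Y]
  rw [this]
  apply natDegree_eq_natDegree
  rw [degree_norm_smul_basis, degree_norm_smul_basis, degree_map, degree_map]

lemma ordReg_galCoord (σ : GalK K) (P : Pt W) (a : CoordRing W) :
    ordReg (galPt σ P) (galCoord W σ a) = ordReg P a := by
  rcases P with _ | ⟨x, y, h⟩
  · change ordReg 0 _ = ordReg 0 _
    rw [ordReg_zero, ordReg_zero, natDegree_norm_galCoord]
  · obtain ⟨h', e⟩ := galPt_some σ h
    rw [e, ordReg_some, ordReg_some, primeOrd_map _ (map_galCoord_XYIdeal σ x y)]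

lemma ord_galFun (σ : GalK K) (P : Pt W) {f : FunField W} (hf : f ≠ 0) :
    ord (galPt σ P) (galFun W σ f) = ord P f :=
  ord_ringEquiv (galCoord W σ) (fun a _ => ordReg_galCoord σ P a) hf

lemma galFun_const (σ : GalK K) (c : AlgebraicClosure K) :
    galFun W σ (const W c) = const W (σ c) := by
  rw [const_apply, const_apply, galFun, IsFractionRing.ringEquivOfRingEquiv_algebraMap,
    algebraMap_eq_mk, galCoord_C, map_C]
  rfl

lemma value_galFun (σ : GalK K) {P : Pt W} {f : FunField W} (hf : f ≠ 0) (hv : ord P f = 0) :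
    value (galPt σ P) (galFun W σ f) = σ (value P f) :=
  value_eq (hasValue_ringEquiv (galFun W σ) (σ : AlgebraicClosure K ≃+* AlgebraicClosure K)
    (galFun_const σ) (fun _ hg => ord_galFun σ P hg) (hasValue_value hf hv))

variable (W) in
/-- The hyperelliptic involution on the function field. -/
noncomputable def hyperFun : FunField W ≃+* FunField W :=
  IsFractionRing.ringEquivOfRingEquiv (hyperEquiv (Ebar W) : CoordRing W ≃+* CoordRing W)

lemma hyperFun_algebraMap (a : CoordRing W) :
    hyperFun W (algebraMap _ _ a) = algebraMap _ _ (hyperEquiv (Ebar W) a) :=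
  IsFractionRing.ringEquivOfRingEquiv_algebraMap ..

lemma hyperFun_const (c : AlgebraicClosure K) : hyperFun W (const W c) = const W c := by
  rw [const_apply, hyperFun_algebraMap, algebraMap_eq_mk, hyperEquiv_C]

lemma ord_hyperFun (P : Pt W) {f : FunField W} (hf : f ≠ 0) :
    ord (-P) (hyperFun W f) = ord P f := by
  refine ord_ringEquiv _ (fun a _ => ?_) hf
  rcases P with _ | ⟨x, y, h⟩
  · change ordReg 0 _ = ordReg 0 _
    rw [ordReg_zero, ordReg_zero]
    exact congrArg (fun p : (AlgebraicClosure K)[X] => -(p.natDegree : ℤ)) (norm_hyperEquiv _ a)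
  · rw [Affine.Point.neg_some, ordReg_some, ordReg_some]
    exact congrArg _ (primeOrd_hyperEquiv x y a)

lemma value_hyperFun {P : Pt W} {f : FunField W} (hf : f ≠ 0) (hv : ord P f = 0) :
    value (-P) (hyperFun W f) = value P f :=
  value_eq (hasValue_ringEquiv (hyperFun W) (RingEquiv.refl _)
    hyperFun_const (fun _ hg => ord_hyperFun P hg) (hasValue_value hf hv))

/-- A function times its conjugate is its norm. -/
lemma mul_hyperFun (a : CoordRing W) :
    algebraMap _ (FunField W) a * hyperFun W (algebraMap _ _ a) =
      algebraMap _ _ (CoordinateRing.mk (Ebar W) (C (Algebra.norm (AlgebraicClosure K)[X] a))) := by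
  rw [hyperFun_algebraMap, ← map_mul, mul_hyperEquiv]

end Automorphisms

/-! ### Divisors of functions -/

section Divisors

open Affine Affine.CoordinateRing

variable {K : Type*} [Field K] {W : WeierstrassCurve K}

lemma some_eq_neg_some_iff {x y : AlgebraicClosure K} (h : (Ebar W).Nonsingular x y) :
    (Affine.Point.some x y h : Pt W) = -.some x y h ↔ y = (Ebar W).negY x y := by
  rw [Affine.Point.neg_some]
  simp

lemma rootMultiplicity_norm_eq_zero {a : CoordRing W} {x : AlgebraicClosure K}
    {S : Finset (AlgebraicClosure K)}
    (hS : ∀ x, (Algebra.norm (AlgebraicClosure K)[X] a).IsRoot x → x ∈ S) (hx : x ∉ S) :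
    (Algebra.norm (AlgebraicClosure K)[X] a).rootMultiplicity x = 0 :=
  rootMultiplicity_eq_zero fun h => hx (hS x h)

lemma natDegree_eq_sum_rootMultiplicity {k : Type*} [Field k] [IsAlgClosed k] {p : k[X]}
    {S : Finset k} (hS : ∀ x, p ≠ 0 → p.IsRoot x → x ∈ S) :
    ∑ x ∈ S, p.rootMultiplicity x = p.natDegree := by
  classical
  rw [(IsAlgClosed.splits p).natDegree_eq_card_roots, ← Multiset.sum_count_eq_card (s := S)]
  · simp only [count_roots]
  · exact fun x hx => hS x (ne_zero_of_mem_roots hx) (isRoot_of_mem_roots hx)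

lemma exists_roots_subset (a : CoordRing W) (ha : a ≠ 0) : ∃ S : Finset (AlgebraicClosure K),
    ∀ x, (Algebra.norm (AlgebraicClosure K)[X] a).IsRoot x → x ∈ S := by
  classical
  exact ⟨(Algebra.norm (AlgebraicClosure K)[X] a).roots.toFinset, fun x hx =>
    Multiset.mem_toFinset.mpr ((mem_roots (norm_ne_zero ha)).mpr hx)⟩

lemma degree_eq_sum {D : Divisor W} {T : Finset (Pt W)} (hT : D.support ⊆ T) :
    degree D = ∑ P ∈ T, D P :=
  D.sum_of_support_subset hT _ fun _ _ => rfl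

variable [W.IsElliptic]

variable (W) in
lemma exists_nonsingular (x : AlgebraicClosure K) : ∃ y, (Ebar W).Nonsingular x y := by
  let q : (AlgebraicClosure K)[X] := X ^ 2 + C ((Ebar W).a₁ * x + (Ebar W).a₃) * X -
    C (x ^ 3 + (Ebar W).a₂ * x ^ 2 + (Ebar W).a₄ * x + (Ebar W).a₆)
  have hq : q.degree ≠ 0 := by
    have : q.degree = 2 := by
      simp only [q]
      compute_degree!
    rw [this]
    decide
  obtain ⟨y, hy⟩ := IsAlgClosed.exists_root q hq
  refine ⟨y, equation_iff_nonsingular.mp ((equation_iff ..).mpr ?_)⟩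
  simp only [q, IsRoot.def, eval_sub, eval_add, eval_pow, eval_X, eval_mul, eval_C] at hy
  linear_combination hy

open scoped Classical in
variable (W) in
/-- The affine points with a given `x`-coordinate. -/
noncomputable def fibre (x : AlgebraicClosure K) : Finset (Pt W) :=
  {.some x _ (exists_nonsingular W x).choose_spec, -.some x _ (exists_nonsingular W x).choose_spec}

lemma mem_fibre {x : AlgebraicClosure K} {P : Pt W} :
    P ∈ fibre W x ↔ ∃ y h, P = .some x y h := by
  classical
  rw [fibre, Finset.mem_insert, Finset.mem_singleton]
  constructor
  · rintro (rfl | rfl)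
    · exact ⟨_, _, rfl⟩
    · exact ⟨_, _, Affine.Point.neg_some _⟩
  · rintro ⟨y, h, rfl⟩
    exact Affine.Point.X_eq_iff.mp rfl

open scoped Classical in
lemma fibre_eq {x y : AlgebraicClosure K} (h : (Ebar W).Nonsingular x y) :
    fibre W x = {.some x y h, -.some x y h} := by
  ext Q
  rw [Finset.mem_insert, Finset.mem_singleton, mem_fibre]
  constructor
  · rintro ⟨y', h', rfl⟩
    exact Affine.Point.X_eq_iff.mp rfl
  · rintro (rfl | rfl)
    · exact ⟨_, _, rfl⟩
    · exact ⟨_, _, Affine.Point.neg_some _⟩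

@[to_additive]
lemma prod_fibre_of_eq {M : Type*} [CommMonoid M] (F : Pt W → M) {x y : AlgebraicClosure K}
    (h : (Ebar W).Nonsingular x y) (hy : y = (Ebar W).negY x y) :
    ∏ P ∈ fibre W x, F P = F (.some x y h) := by
  classical
  rw [fibre_eq h, ← (some_eq_neg_some_iff h).mpr hy, Finset.pair_eq_singleton,
    Finset.prod_singleton]

@[to_additive]
lemma prod_fibre_of_ne {M : Type*} [CommMonoid M] (F : Pt W → M) {x y : AlgebraicClosure K}
    (h : (Ebar W).Nonsingular x y) (hy : y ≠ (Ebar W).negY x y) :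
    ∏ P ∈ fibre W x, F P = F (.some x y h) * F (-.some x y h) := by
  classical
  rw [fibre_eq h, Finset.prod_pair fun e => hy ((some_eq_neg_some_iff h).mp e)]

open scoped Classical in
variable (W) in
/-- The point at infinity together with the points whose `x`-coordinate lies in a finite set. -/
noncomputable def pointsOver (S : Finset (AlgebraicClosure K)) : Finset (Pt W) :=
  insert 0 (S.biUnion (fibre W))

@[to_additive]
lemma prod_pointsOver {M : Type*} [CommMonoid M] (F : Pt W → M)
    (S : Finset (AlgebraicClosure K)) :
    ∏ P ∈ pointsOver W S, F P = F 0 * ∏ x ∈ S, ∏ P ∈ fibre W x, F P := by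
  classical
  rw [pointsOver, Finset.prod_insert, Finset.prod_biUnion]
  · intro x _ x' _ hne
    refine Finset.disjoint_left.mpr fun P hP hP' => hne ?_
    obtain ⟨y, h, rfl⟩ := mem_fibre.mp hP
    obtain ⟨y', h', e⟩ := mem_fibre.mp hP'
    exact (Affine.Point.some.inj e).1
  · rw [Finset.mem_biUnion]
    rintro ⟨x, -, hx⟩
    obtain ⟨y, h, e⟩ := mem_fibre.mp hx
    exact Affine.Point.some_ne_zero h e.symm

lemma zero_mem_pointsOver (S : Finset (AlgebraicClosure K)) : 0 ∈ pointsOver W S := by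
  classical exact Finset.mem_insert_self _ _

lemma some_mem_pointsOver {S : Finset (AlgebraicClosure K)} {x y : AlgebraicClosure K}
    {h : (Ebar W).Nonsingular x y} (hx : x ∈ S) : .some x y h ∈ pointsOver W S := by
  classical
  exact Finset.mem_insert_of_mem (Finset.mem_biUnion.mpr ⟨x, hx, mem_fibre.mpr ⟨y, h, rfl⟩⟩)

/-- The zeros of a regular function above `x`, with multiplicities, are counted by the zero of its
norm at `x`. -/
lemma sum_fibre_ordReg {a : CoordRing W} (ha : a ≠ 0) (x : AlgebraicClosure K) :
    ∑ P ∈ fibre W x, ordReg P a =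
      ((Algebra.norm (AlgebraicClosure K)[X] a).rootMultiplicity x : ℤ) := by
  obtain ⟨y, h⟩ := exists_nonsingular W x
  by_cases hy : y = (Ebar W).negY x y
  · rw [sum_fibre_of_eq _ h hy, ordReg_some, primeOrd_eq_rootMultiplicity_norm h hy ha]
  · rw [sum_fibre_of_ne _ h hy, Affine.Point.neg_some, ordReg_some, ordReg_some,
      ← primeOrd_add_primeOrd_neg h hy ha]
    push_cast; rfl

lemma mem_pointsOver_of_ordReg_ne_zero {a : CoordRing W} (ha : a ≠ 0)
    {S : Finset (AlgebraicClosure K)}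
    (hS : ∀ x, (Algebra.norm (AlgebraicClosure K)[X] a).IsRoot x → x ∈ S) {P : Pt W}
    (hP : ordReg P a ≠ 0) : P ∈ pointsOver W S := by
  rcases P with _ | ⟨x, y, h⟩
  · exact zero_mem_pointsOver S
  · refine some_mem_pointsOver (by_contra fun hx => hP ?_)
    have h0 := sum_fibre_ordReg ha x
    rw [rootMultiplicity_norm_eq_zero hS hx, Nat.cast_zero,
      Finset.sum_eq_zero_iff_of_nonneg] at h0
    · exact h0 _ (mem_fibre.mpr ⟨y, h, rfl⟩)
    · intro Q hQ
      obtain ⟨y', h', rfl⟩ := mem_fibre.mp hQ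
      rw [ordReg_some]
      exact Nat.cast_nonneg _

lemma sum_pointsOver_ordReg {a : CoordRing W} (ha : a ≠ 0) {S : Finset (AlgebraicClosure K)}
    (hS : ∀ x, (Algebra.norm (AlgebraicClosure K)[X] a).IsRoot x → x ∈ S) :
    ∑ P ∈ pointsOver W S, ordReg P a = 0 := by
  rw [sum_pointsOver, ordReg_zero, ← natDegree_eq_sum_rootMultiplicity fun x _ => hS x,
    Finset.sum_congr rfl fun x _ => sum_fibre_ordReg ha x]
  push_cast
  ring

/-- A nonzero function has finitely many zeros and poles, and they balance. -/
lemma exists_pointsOver {f : FunField W} (hf : f ≠ 0) : ∃ S₀ : Finset (AlgebraicClosure K),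
    ∀ S, S₀ ⊆ S → (∀ P, ord P f ≠ 0 → P ∈ pointsOver W S) ∧
      ∑ P ∈ pointsOver W S, ord P f = 0 := by
  classical
  obtain ⟨a, b, ha, hb, hab⟩ := exists_mul_eq hf
  obtain ⟨Sa, hSa⟩ := exists_roots_subset a ha
  obtain ⟨Sb, hSb⟩ := exists_roots_subset b hb
  refine ⟨Sa ∪ Sb, fun S hS => ?_⟩
  have hSa' := fun x hx => hS (Finset.mem_union_left Sb (hSa x hx))
  have hSb' := fun x hx => hS (Finset.mem_union_right Sa (hSb x hx))
  constructor
  · intro P hP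
    rw [ord_eq_of_mul_eq P ha hb hab] at hP
    by_cases hPa : ordReg P a = 0
    · exact mem_pointsOver_of_ordReg_ne_zero hb hSb' (P := P) (by omega)
    · exact mem_pointsOver_of_ordReg_ne_zero ha hSa' hPa
  · simp only [ord_eq_of_mul_eq _ ha hb hab, Finset.sum_sub_distrib]
    rw [sum_pointsOver_ordReg ha hSa', sum_pointsOver_ordReg hb hSb', sub_zero]

lemma degree_eq_zero_of_isDivOf {D : Divisor W} {f : FunField W} (h : IsDivOf D f) :
    degree D = 0 := by
  obtain ⟨S, hS⟩ := exists_pointsOver h.1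
  obtain ⟨hmem, hsum⟩ := hS S subset_rfl
  rw [degree_eq_sum (T := pointsOver W S)]
  · simp only [h.2, hsum]
  · exact fun P hP => hmem P (by rw [← h.2]; exact Finsupp.mem_support_iff.mp hP)

lemma exists_isDivOf {f : FunField W} (hf : f ≠ 0) : ∃ D : Divisor W, IsDivOf D f := by
  obtain ⟨S, hS⟩ := exists_pointsOver hf
  exact ⟨Finsupp.onFinset (pointsOver W S) (fun P => ord P f) (hS S subset_rfl).1, hf,
    fun _ => rfl⟩

/-! #### Functions without zeros and poles -/

lemma induction_of_isAlgClosed {k : Type*} [Field k] [IsAlgClosed k] {motive : k[X] → Prop}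
    (const : ∀ c, c ≠ 0 → motive (C c))
    (mul : ∀ x p, p ≠ 0 → motive p → motive ((X - C x) * p)) {p : k[X]} (hp : p ≠ 0) :
    motive p := by
  induction hn : p.natDegree generalizing p with
  | zero =>
    rw [eq_C_of_natDegree_eq_zero hn] at hp ⊢
    exact const _ fun h0 => hp (by rw [h0, C_0])
  | succ n ih =>
    obtain ⟨x, hx⟩ := IsAlgClosed.exists_root p fun h0 => by
      rw [natDegree_eq_zero_iff_degree_le_zero.mpr h0.le] at hn
      omega
    obtain ⟨q, rfl⟩ := dvd_iff_isRoot.mpr hx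
    have hq : q ≠ 0 := right_ne_zero_of_mul hp
    refine mul x q hq (ih hq ?_)
    rw [natDegree_mul (X_sub_C_ne_zero x) hq, natDegree_X_sub_C] at hn
    omega

/-- If `f` has no poles at the affine points, then `x - x₀` cannot be its denominator. -/
lemma exists_eq_algebraMap_of_mul_XClass {f : FunField W} (hf : f ≠ 0) {a : CoordRing W}
    {x : AlgebraicClosure K} (hfa : f * algebraMap _ _ (XClass (Ebar W) x) = algebraMap _ _ a)
    (hord : ∀ P : Pt W, P ≠ 0 → 0 ≤ ord P f) : ∃ b : CoordRing W, f = algebraMap _ _ b := by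
  have hX : XClass (Ebar W) x ≠ 0 := XClass_ne_zero x
  have ha : a ≠ 0 := by
    rintro rfl
    rw [map_zero] at hfa
    exact mul_ne_zero hf (algebraMap_ne_zero hX) hfa
  have hle : ∀ {y} (h : (Ebar W).Nonsingular x y),
      primeOrd (XYIdeal (Ebar W) x (C y)) (XClass (Ebar W) x) ≤
        primeOrd (XYIdeal (Ebar W) x (C y)) a := fun h => by
    have := hord (.some x _ h) (Affine.Point.some_ne_zero h)
    rw [ord_eq_of_mul_eq _ ha hX hfa, ordReg_some, ordReg_some] at this
    omega
  have hmem : a ∈ XIdeal (Ebar W) x := by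
    obtain ⟨y, h⟩ := exists_nonsingular W x
    have hP := XYIdeal_isInvertiblePrime h
    rw [← XYIdeal_neg_mul h]
    by_cases hy : y = (Ebar W).negY x y
    · have := hle h
      rw [primeOrd_XClass_of_eq h hy] at this
      rw [← hy, ← pow_two]
      exact (hP.mem_pow_iff_le_primeOrd ha).mpr this
    · have h' := (nonsingular_neg x y).mpr h
      have hyn : (Ebar W).negY x y ≠ (Ebar W).negY x ((Ebar W).negY x y) := by
        rw [negY_negY]
        exact Ne.symm hy
      have h1 := hle h
      have h2 := hle h'
      rw [primeOrd_XClass_of_ne h hy] at h1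
      rw [primeOrd_XClass_of_ne h' hyn] at h2
      rw [Ideal.mul_eq_inf_of_coprime]
      · exact ⟨((XYIdeal_isInvertiblePrime h').primeOrd_pos_iff ha).mp h2,
          (hP.primeOrd_pos_iff ha).mp h1⟩
      · exact (XYIdeal_isMaximal h'.1).coprime_of_ne (XYIdeal_isMaximal h.1) fun e =>
          hy (XYIdeal_injective h.1 e.le).symm
  obtain ⟨b, hb⟩ := Ideal.mem_span_singleton'.mp hmem
  refine ⟨b, mul_right_cancel₀ (algebraMap_ne_zero hX) ?_⟩
  rw [hfa, ← hb, map_mul]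

/-- A function without poles at the affine points is regular. -/
lemma exists_eq_algebraMap_of_ord_nonneg {f : FunField W} (hf : f ≠ 0)
    (hord : ∀ P : Pt W, P ≠ 0 → 0 ≤ ord P f) : ∃ a : CoordRing W, f = algebraMap _ _ a := by
  obtain ⟨a, b, -, hb, hab⟩ := exists_mul_eq hf
  have main : ∀ p : (AlgebraicClosure K)[X], p ≠ 0 → ∀ a : CoordRing W,
      f * algebraMap _ _ (CoordinateRing.mk (Ebar W) (C p)) = algebraMap _ _ a →
        ∃ a : CoordRing W, f = algebraMap _ _ a := by
    intro p hp
    refine induction_of_isAlgClosed (motive := fun p => ∀ a : CoordRing W,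
      f * algebraMap _ _ (CoordinateRing.mk (Ebar W) (C p)) = algebraMap _ _ a →
        ∃ a : CoordRing W, f = algebraMap _ _ a) (fun c hc => ?_) (fun x p hp ih => ?_) hp
    · intro a h
      refine ⟨algebraMap _ _ c⁻¹ * a, ?_⟩
      rw [map_mul, ← h, mul_left_comm, ← map_mul, ← algebraMap_eq_mk, ← map_mul,
        inv_mul_cancel₀ hc, map_one, map_one, mul_one]
    · intro a h
      have hp' := algebraMap_ne_zero (mk_C_ne_zero (W := Ebar W) hp)
      obtain ⟨b, hb⟩ := exists_eq_algebraMap_of_mul_XClass (mul_ne_zero hf hp') (x := x) (a := a)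
        (by rw [← h, XClass, C_mul, map_mul, map_mul]; ring) fun P hP => by
          rw [(isPlace_ord P).mul hf hp', ord_algebraMap P (mk_C_ne_zero hp)]
          refine add_nonneg (hord P hP) ?_
          rcases P with _ | ⟨x, y, h⟩
          · exact absurd rfl hP
          · exact Nat.cast_nonneg _
      exact ih b hb
  refine main _ (norm_ne_zero hb) (a * hyperEquiv (Ebar W) b) ?_
  rw [← mul_hyperEquiv, map_mul, map_mul, ← hab, mul_assoc]

/-- A function without zeros and poles is constant. -/
lemma exists_eq_const {f : FunField W} (hf : f ≠ 0) (hord : ∀ P : Pt W, ord P f = 0) :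
    ∃ c, c ≠ 0 ∧ f = const W c := by
  obtain ⟨a, rfl⟩ := exists_eq_algebraMap_of_ord_nonneg hf fun P _ => (hord P).ge
  have ha : a ≠ 0 := fun h0 => hf (by rw [h0, map_zero])
  have h0 := hord 0
  rw [ord_algebraMap 0 ha, ordReg_zero] at h0
  obtain ⟨c, rfl⟩ := exists_eq_algebraMap_of_natDegree_norm_eq_zero (a := a) (by omega)
  exact ⟨c, fun hc => ha (by rw [hc, map_zero]), rfl⟩

end Divisors

/-! ### Weil reciprocity -/

section Reciprocity

open Affine Affine.CoordinateRing

variable {K : Type*} [Field K] {W : WeierstrassCurve K}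

/-- The tame symbol of two functions at a point. -/
noncomputable def tame (P : Pt W) (f g : FunField W) : AlgebraicClosure K :=
  value P (tameFun (ord P) f g)

lemma tame_eq_of_hasValue {P : Pt W} {f g : FunField W} {c : AlgebraicClosure K}
    (h : HasValue (const W) (ord P) (tameFun (ord P) f g) c) : tame P f g = c :=
  value_eq h

lemma tame_mul_left (P : Pt W) {f₁ f₂ g : FunField W} (h₁ : f₁ ≠ 0) (h₂ : f₂ ≠ 0) (hg : g ≠ 0) :
    tame P (f₁ * f₂) g = tame P f₁ g * tame P f₂ g := by
  have h := isPlace_ord P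
  rw [tame, h.tameFun_mul_left h₁ h₂ hg, value_mul (IsPlace.tameFun_ne_zero h₁ hg)
    (IsPlace.tameFun_ne_zero h₂ hg) (h.ord_tameFun h₁ hg) (h.ord_tameFun h₂ hg)]
  rfl

lemma tame_mul_swap (P : Pt W) {f g : FunField W} (hf : f ≠ 0) (hg : g ≠ 0) :
    tame P f g * tame P g f = 1 := by
  have h := isPlace_ord P
  rw [tame, tame, ← value_mul (IsPlace.tameFun_ne_zero hf hg) (IsPlace.tameFun_ne_zero hg hf)
    (h.ord_tameFun hf hg) (h.ord_tameFun hg hf), IsPlace.tameFun_mul_swap hf hg, value_one]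

lemma tame_eq_one {P : Pt W} {f g : FunField W} (hf : ord P f = 0) (hg : ord P g = 0) :
    tame P f g = 1 := by
  rw [tame, IsPlace.tameFun_eq_one hf hg, value_one]

lemma tame_const (P : Pt W) (f : FunField W) {c : AlgebraicClosure K} (hc : c ≠ 0) :
    tame P f (const W c) = c ^ (-ord P f) := by
  have h := isPlace_ord P
  refine tame_eq_of_hasValue ?_
  rw [tameFun, h.const hc, mul_zero, zpow_zero, zpow_zero, one_mul, one_mul]
  exact h.hasValue_zpow IsPlace.hasValue_const hc _

/-! #### Tame symbols with `x - x₀` -/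

/-- The function `p(x)` on the curve. -/
noncomputable def polyFun (W : WeierstrassCurve K) (p : (AlgebraicClosure K)[X]) : FunField W :=
  algebraMap (CoordRing W) (FunField W) (CoordinateRing.mk (Ebar W) (C p))

lemma polyFun_ne_zero {p : (AlgebraicClosure K)[X]} (hp : p ≠ 0) : polyFun W p ≠ 0 :=
  algebraMap_ne_zero (mk_C_ne_zero hp)

lemma polyFun_mul (p q : (AlgebraicClosure K)[X]) :
    polyFun W (p * q) = polyFun W p * polyFun W q := by
  simp only [polyFun, map_mul]

lemma polyFun_sub (p q : (AlgebraicClosure K)[X]) :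
    polyFun W (p - q) = polyFun W p - polyFun W q := by
  simp only [polyFun, map_sub]

lemma polyFun_pow (p : (AlgebraicClosure K)[X]) (n : ℕ) :
    polyFun W (p ^ n) = polyFun W p ^ n := by
  simp only [polyFun, map_pow]

lemma polyFun_C (c : AlgebraicClosure K) : polyFun W (C c) = const W c := rfl

lemma hyperFun_polyFun (p : (AlgebraicClosure K)[X]) :
    hyperFun W (polyFun W p) = polyFun W p := by
  rw [polyFun, hyperFun_algebraMap, hyperEquiv_C]

lemma mul_hyperFun_eq_polyFun (a : CoordRing W) :
    algebraMap _ (FunField W) a * hyperFun W (algebraMap _ _ a) =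
      polyFun W (Algebra.norm (AlgebraicClosure K)[X] a) :=
  mul_hyperFun a

lemma ord_zero_polyFun {p : (AlgebraicClosure K)[X]} (hp : p ≠ 0) :
    ord (0 : Pt W) (polyFun W p) = -(2 * p.natDegree) := by
  rw [polyFun, ord_algebraMap 0 (mk_C_ne_zero hp), ordReg_zero, norm_C, natDegree_pow]
  push_cast
  rfl

lemma hasValue_polyFun {x y : AlgebraicClosure K} (h : (Ebar W).Nonsingular x y)
    (p : (AlgebraicClosure K)[X]) :
    HasValue (const W) (ord (.some x y h : Pt W)) (polyFun W p) (p.eval x) := by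
  rw [IsPlace.hasValue_iff, polyFun, const_apply, ← map_sub]
  have hmem := mk_C_sub_eval_mem (W := Ebar W) p x (C y)
  by_cases h0 : CoordinateRing.mk (Ebar W) (C p) - algebraMap _ (CoordRing W) (p.eval x) = 0
  · exact Or.inl (by rw [h0, map_zero])
  · right
    rw [ord_algebraMap _ h0, ordReg_some]
    exact_mod_cast ((XYIdeal_isInvertiblePrime h).primeOrd_pos_iff h0).mpr hmem

/-- At infinity, a polynomial in `x` of degree `d` behaves like its leading term. -/
lemma hasValue_zero_polyFun_div {p : (AlgebraicClosure K)[X]} (hp : p ≠ 0)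
    (x : AlgebraicClosure K) :
    HasValue (const W) (ord (0 : Pt W)) (polyFun W p / polyFun W (X - C x) ^ p.natDegree)
      p.leadingCoeff := by
  have hq : (X - C x) ^ p.natDegree ≠ 0 := pow_ne_zero _ (X_sub_C_ne_zero x)
  set q : (AlgebraicClosure K)[X] := (X - C x) ^ p.natDegree with hqdef
  have hqmonic : q.Monic := (monic_X_sub_C x).pow _
  have hqdeg : q.natDegree = p.natDegree := by rw [hqdef, natDegree_pow, natDegree_X_sub_C, mul_one]
  have hlc : p.leadingCoeff ≠ 0 := leadingCoeff_ne_zero.mpr hp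
  rw [← polyFun_pow, ← hqdef, IsPlace.hasValue_iff, ← polyFun_C,
    div_sub' (polyFun_ne_zero hq), mul_comm, ← polyFun_mul, ← polyFun_sub]
  by_cases h0 : p - C p.leadingCoeff * q = 0
  · left
    rw [h0]
    simp [polyFun]
  · right
    rw [(isPlace_ord 0).map_div (polyFun_ne_zero h0) (polyFun_ne_zero hq), ord_zero_polyFun h0,
      ord_zero_polyFun hq, hqdeg]
    have hlt : (p - C p.leadingCoeff * q).natDegree < p.natDegree := by
      refine natDegree_lt_natDegree h0 (degree_sub_lt_left ?_ hp ?_)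
      · rw [degree_C_mul hlc, degree_eq_natDegree hp, degree_eq_natDegree hq, hqdeg]
      · rw [leadingCoeff_C_mul_of_isUnit (IsUnit.mk0 _ hlc), hqmonic.leadingCoeff, mul_one]
    omega

/-- The involution acts as `-1` on the cotangent space at infinity, spanned by `x / y`. -/
lemma hasValue_hyperFun_div_zero {f : FunField W} (hf : f ≠ 0) :
    HasValue (const W) (ord (0 : Pt W)) (hyperFun W f / f) ((-1) ^ ord (0 : Pt W) f) := by
  have h := isPlace_ord (0 : Pt W)
  have hι : ∀ f : FunField W, f ≠ 0 → ord (0 : Pt W) (hyperFun W f) = ord 0 f := fun f hf =>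
    ord_hyperFun 0 hf
  have hX := polyFun_ne_zero (W := W) X_ne_zero
  set y : FunField W := algebraMap _ _ (CoordinateRing.mk (Ebar W) Y) with hydef
  have hY : CoordinateRing.mk (Ebar W) Y ≠ 0 := by
    simpa [YClass] using YClass_ne_zero (W' := Ebar W) 0
  have hy0 : y ≠ 0 := algebraMap_ne_zero hY
  have hvX : ord (0 : Pt W) (polyFun W X) = -2 := by rw [ord_zero_polyFun X_ne_zero]; simp
  have hvy : ord (0 : Pt W) y = -3 := by
    have hdeg : (Algebra.norm (AlgebraicClosure K)[X] (CoordinateRing.mk (Ebar W) Y)).degree =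
        (3 : ℕ) := by
      have := degree_norm_smul_basis (W' := Ebar W) 0 1
      rw [zero_smul, zero_add, one_smul, degree_zero, degree_one, smul_zero, zero_add] at this
      rw [this]
      exact max_eq_right bot_le
    rw [hydef, ord_algebraMap 0 hY, ordReg_zero, natDegree_eq_of_degree_eq_some hdeg]
    rfl
  have hyval : HasValue (const W) (ord (0 : Pt W)) (hyperFun W y / y) (-1) := by
    have hsum : hyperFun W y + y = -polyFun W (C (Ebar W).a₁ * X + C (Ebar W).a₃) := by
      rw [hydef, hyperFun_algebraMap, hyperEquiv_Y, mk_negPolynomial, map_sub, map_neg, polyFun]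
      ring
    rw [IsPlace.hasValue_iff, map_neg, map_one, sub_neg_eq_add, div_add_one hy0, hsum]
    by_cases h0 : C (Ebar W).a₁ * X + C (Ebar W).a₃ = 0
    · left
      rw [h0]
      simp [polyFun]
    · right
      have hp := polyFun_ne_zero (W := W) h0
      rw [h.map_div (neg_ne_zero.mpr hp) hy0, h.map_neg hp, ord_zero_polyFun h0, hvy]
      have := natDegree_linear_le (a := (Ebar W).a₁) (b := (Ebar W).a₃)
      omega
  refine h.hasValue_div_of_involution (hyperFun W) hι hyperFun_const
    (t := polyFun W X / y) (div_ne_zero hX hy0) (by rw [h.map_div hX hy0, hvX, hvy]; rfl) ?_ hf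
  have := h.hasValue_inv hyval (neg_ne_zero.mpr one_ne_zero)
  rw [inv_neg_one] at this
  convert this using 1
  have : hyperFun W y ≠ 0 := (_root_.map_ne_zero _).mpr hy0
  rw [map_div₀, hyperFun_polyFun]
  field_simp

/-- The involution acts as `-1` on the cotangent space at a point `P = -P`, spanned by
`y - y_P`. -/
lemma hasValue_hyperFun_div_some {x y : AlgebraicClosure K} (hP : (Ebar W).Nonsingular x y)
    (hy : y = (Ebar W).negY x y) {f : FunField W} (hf : f ≠ 0) :
    HasValue (const W) (ord (.some x y hP : Pt W)) (hyperFun W f / f)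
      ((-1) ^ ord (.some x y hP : Pt W) f) := by
  have h := isPlace_ord (.some x y hP : Pt W)
  have hneg : (Affine.Point.some x y hP : Pt W) = -.some x y hP :=
    (some_eq_neg_some_iff hP).mpr hy
  have hι : ∀ f : FunField W, f ≠ 0 →
      ord (.some x y hP : Pt W) (hyperFun W f) = ord (.some x y hP) f := fun f hf => by
    conv_lhs => rw [hneg]
    exact ord_hyperFun _ hf
  have hY := YClass_ne_zero (W' := Ebar W) (C y)
  set t : FunField W := algebraMap _ _ (YClass (Ebar W) (C y)) with htdef
  have ht0 : t ≠ 0 := algebraMap_ne_zero hY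
  have hvt : ord (.some x y hP : Pt W) t = 1 := by
    rw [htdef, ord_algebraMap _ hY, ordReg_some, primeOrd_YClass_of_eq hP hy]
    rfl
  refine h.hasValue_div_of_involution (hyperFun W) hι hyperFun_const ht0 hvt ?_ hf
  have hsum : hyperFun W t + t = const W (-(Ebar W).a₁) * polyFun W (X - C x) := by
    have h2 : 2 * y = -((Ebar W).a₁ * x) - (Ebar W).a₃ := by
      rw [negY] at hy
      linear_combination hy
    have h3 := congrArg (fun c => CoordinateRing.mk (Ebar W) (C (C c))) h2
    simp only [map_mul, map_sub, map_neg, map_ofNat] at h3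
    rw [← polyFun_C, ← polyFun_mul, htdef, hyperFun_algebraMap, polyFun, ← map_add]
    congr 1
    simp only [YClass, map_sub, map_mul, map_neg, map_add, hyperEquiv_C, hyperEquiv_Y,
      mk_negPolynomial]
    linear_combination -h3
  rw [IsPlace.hasValue_iff, map_neg, map_one, sub_neg_eq_add, div_add_one ht0, hsum]
  by_cases ha : (Ebar W).a₁ = 0
  · left
    rw [ha, neg_zero, map_zero, zero_mul, zero_div]
  · right
    have hc : -(Ebar W).a₁ ≠ 0 := neg_ne_zero.mpr ha
    have hc' : const W (-(Ebar W).a₁) ≠ 0 := (_root_.map_ne_zero _).mpr hc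
    have hX := polyFun_ne_zero (W := W) (X_sub_C_ne_zero x)
    rw [h.map_div (mul_ne_zero hc' hX) ht0, h.mul hc' hX, h.const hc, hvt, polyFun,
      ord_algebraMap _ (mk_C_ne_zero (X_sub_C_ne_zero x)), ordReg_some, ← XClass,
      primeOrd_XClass_of_eq hP hy]
    norm_num

/-- The tame symbol with `x - x₀` at infinity. -/
lemma tame_zero_X_sub_C (x : AlgebraicClosure K) {a : CoordRing W} (ha : a ≠ 0) :
    tame 0 (polyFun W (X - C x)) (algebraMap _ _ a) =
      (-1) ^ (Algebra.norm (AlgebraicClosure K)[X] a).natDegree *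
        (Algebra.norm (AlgebraicClosure K)[X] a).leadingCoeff := by
  set N := Algebra.norm (AlgebraicClosure K)[X] a with hN
  have hN0 : N ≠ 0 := norm_ne_zero ha
  have h := isPlace_ord (0 : Pt W)
  have hX := polyFun_ne_zero (W := W) (X_sub_C_ne_zero x)
  have ha' := algebraMap_ne_zero ha
  have hι : hyperFun W (algebraMap _ _ a) ≠ 0 := (_root_.map_ne_zero _).mpr ha'
  have hva : ord (0 : Pt W) (algebraMap _ _ a) = -(N.natDegree : ℤ) := by
    rw [ord_algebraMap 0 ha, ordReg_zero]
  have hvX : ord (0 : Pt W) (polyFun W (X - C x)) = -2 := by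
    rw [ord_zero_polyFun (X_sub_C_ne_zero x), natDegree_X_sub_C]
    rfl
  have h1 := h.hasValue_inv (hasValue_hyperFun_div_zero ha')
    (zpow_ne_zero _ (neg_ne_zero.mpr one_ne_zero))
  rw [← zpow_neg, hva, neg_neg, zpow_natCast] at h1
  have h2 := h.hasValue_mul h1 (hasValue_zero_polyFun_div hN0 x)
  refine tame_eq_of_hasValue ?_
  convert h2 using 1
  rw [tameFun, hva, hvX, ← mul_hyperFun_eq_polyFun, neg_neg, zpow_neg, zpow_natCast, inv_div,
    (by decide : Even (-2 : ℤ)).mul_right _ |>.neg_one_zpow]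
  field_simp

end Reciprocity

section Reciprocity

open Affine Affine.CoordinateRing

variable {K : Type*} [Field K] {W : WeierstrassCurve K}
/-! #### The product of all tame symbols -/

/-- The product of all tame symbols of two functions. -/
noncomputable def tameProd (f g : FunField W) : AlgebraicClosure K := ∏ᶠ P : Pt W, tame P f g

/-- The Steinberg relation. -/
lemma tameProd_eq_one_of_add_eq_one {f g : FunField W} (hf : f ≠ 0) (hg : g ≠ 0)
    (hfg : f + g = 1) : tameProd f g = 1 :=
  finprod_eq_one_of_forall_eq_one fun P =>
    tame_eq_of_hasValue ((isPlace_ord P).hasValue_tameFun_of_add_eq_one hf hg hfg)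

lemma tameProd_neg_self {f : FunField W} (hf : f ≠ 0) : tameProd f (-f) = 1 :=
  finprod_eq_one_of_forall_eq_one fun P => by
    rw [tame, (isPlace_ord P).tameFun_neg_self hf, value_one]

/-! #### The fibres of the double cover -/

variable [W.IsElliptic]

/-- The product of the tame symbols with `x - x₀` at the points above `x₀`. -/
lemma prod_fibre_tame_X_sub_C {x : AlgebraicClosure K} {a : CoordRing W} (ha : a ≠ 0) {n : ℕ}
    {m : (AlgebraicClosure K)[X]} (hm : m.eval x ≠ 0)
    (hN : Algebra.norm (AlgebraicClosure K)[X] a = (X - C x) ^ n * m) :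
    ∏ P ∈ fibre W x, tame P (polyFun W (X - C x)) (algebraMap _ _ a) =
      (-1) ^ n * (m.eval x)⁻¹ := by
  obtain ⟨y, hP⟩ := exists_nonsingular W x
  have hXC := X_sub_C_ne_zero x
  have hm0 : m ≠ 0 := by rintro rfl; simp at hm
  have hmult : (Algebra.norm (AlgebraicClosure K)[X] a).rootMultiplicity x = n := by
    rw [hN, mul_comm, rootMultiplicity_mul_X_sub_C_pow hm0, rootMultiplicity_eq_zero hm, zero_add]
  have h := isPlace_ord (.some x y hP : Pt W)
  set f : FunField W := algebraMap _ _ a with hf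
  set ξ : FunField W := polyFun W (X - C x) with hξ
  have hf0 : f ≠ 0 := algebraMap_ne_zero ha
  have hξ0 : ξ ≠ 0 := polyFun_ne_zero hXC
  have hι0 : hyperFun W f ≠ 0 := (_root_.map_ne_zero _).mpr hf0
  have hM0 : polyFun W m ≠ 0 := polyFun_ne_zero hm0
  have hnorm : f * hyperFun W f = ξ ^ n * polyFun W m := by
    rw [hf, mul_hyperFun_eq_polyFun, hN, polyFun_mul, polyFun_pow]
  have hMinv := h.hasValue_inv (hasValue_polyFun hP m) hm
  by_cases hy : y = (Ebar W).negY x y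
  · rw [prod_fibre_of_eq _ hP hy]
    have hvξ : ord (.some x y hP : Pt W) ξ = 2 := by
      rw [hξ, polyFun, ord_algebraMap _ (mk_C_ne_zero hXC), ordReg_some, ← XClass,
        primeOrd_XClass_of_eq hP hy]
      rfl
    have hvf : ord (.some x y hP : Pt W) f = n := by
      rw [hf, ord_algebraMap _ ha, ordReg_some, primeOrd_eq_rootMultiplicity_norm hP hy ha, hmult]
    have hinv := hasValue_hyperFun_div_some hP hy hf0
    rw [hvf, zpow_natCast] at hinv
    refine tame_eq_of_hasValue ?_
    convert h.hasValue_mul hinv hMinv using 1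
    have hM : (polyFun W m)⁻¹ = ξ ^ n / (f * hyperFun W f) := by
      rw [hnorm]
      field_simp
    rw [tameFun, hvξ, hvf, hM, ((by decide : Even (2 : ℤ)).mul_right _).neg_one_zpow, zpow_natCast,
      zpow_neg]
    field_simp
  · rw [prod_fibre_of_ne _ hP hy]
    have hvξ : ord (.some x y hP : Pt W) ξ = 1 := by
      rw [hξ, polyFun, ord_algebraMap _ (mk_C_ne_zero hXC), ordReg_some, ← XClass,
        primeOrd_XClass_of_ne hP hy]
      rfl
    have hξι : hyperFun W ξ = ξ := hyperFun_polyFun _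
    have hvξ' : ord (-.some x y hP : Pt W) ξ = 1 := by
      rw [← hvξ, ← ord_hyperFun _ hξ0, hξι, neg_neg]
    have hsum : ord (.some x y hP : Pt W) f + ord (-.some x y hP : Pt W) f = n := by
      rw [hf, ord_algebraMap _ ha, ord_algebraMap _ ha, Affine.Point.neg_some, ordReg_some,
        ordReg_some, ← hmult, ← primeOrd_add_primeOrd_neg hP hy ha]
      push_cast; rfl
    have h' := isPlace_ord (-.some x y hP : Pt W)
    -- the symbol at `-P` is the value at `P` of the conjugate function
    have hconj : tame (-.some x y hP : Pt W) ξ f = value (.some x y hP : Pt W)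
        (hyperFun W (tameFun (ord (-.some x y hP : Pt W)) ξ f)) := by
      have := value_hyperFun (IsPlace.tameFun_ne_zero hξ0 hf0) (h'.ord_tameFun hξ0 hf0)
      rw [neg_neg] at this
      rw [this, tame]
    have hcv : ord (.some x y hP : Pt W)
        (hyperFun W (tameFun (ord (-.some x y hP : Pt W)) ξ f)) = 0 := by
      have := ord_hyperFun (-.some x y hP : Pt W)
        (IsPlace.tameFun_ne_zero (v := ord (-.some x y hP : Pt W)) hξ0 hf0)
      rw [neg_neg] at this
      rw [this, h'.ord_tameFun hξ0 hf0]
    rw [hconj, tame, ← value_mul (IsPlace.tameFun_ne_zero hξ0 hf0)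
      ((_root_.map_ne_zero _).mpr (IsPlace.tameFun_ne_zero hξ0 hf0)) (h.ord_tameFun hξ0 hf0) hcv]
    refine value_eq ?_
    convert h.hasValue_mul (IsPlace.hasValue_neg_one_zpow n) hMinv using 1
    · have hM : (polyFun W m)⁻¹ = ξ ^ (n : ℤ) / (f * hyperFun W f) := by
        rw [hnorm, zpow_natCast]
        field_simp
      rw [tameFun, tameFun, hvξ, hvξ', hM, ← hsum, map_mul, map_mul, map_zpow₀, map_zpow₀,
        map_zpow₀, hξι, map_neg, map_one, one_mul, one_mul, zpow_neg_one, zpow_neg_one,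
        zpow_add₀ hξ0, zpow_add₀ (neg_ne_zero.mpr one_ne_zero)]
      field_simp
    · rw [zpow_natCast]

lemma prod_zpow_eq_zpow_sum {ι G : Type*} [Field G] {c : G} (hc : c ≠ 0) (s : Finset ι)
    (n : ι → ℤ) : ∏ i ∈ s, c ^ n i = c ^ ∑ i ∈ s, n i := by
  classical
  induction s using Finset.induction_on with
  | empty => simp
  | insert i s hi ih => rw [Finset.prod_insert hi, Finset.sum_insert hi, zpow_add₀ hc, ih]

/-- The product of the tame symbols with `x - x₀` at the points above `x₁ ≠ x₀`. -/
lemma prod_fibre_tame_X_sub_C_of_ne {x x' : AlgebraicClosure K} (hx : x' ≠ x) {a : CoordRing W}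
    (ha : a ≠ 0) :
    ∏ P ∈ fibre W x', tame P (polyFun W (X - C x)) (algebraMap _ _ a) =
      (x' - x) ^ (Algebra.norm (AlgebraicClosure K)[X] a).rootMultiplicity x' := by
  have hxx : x' - x ≠ 0 := sub_ne_zero.mpr hx
  have key : ∀ P ∈ fibre W x', tame P (polyFun W (X - C x)) (algebraMap _ _ a) =
      (x' - x) ^ ordReg P a := fun P hP => by
    obtain ⟨y, h, rfl⟩ := mem_fibre.mp hP
    have hpl := isPlace_ord (.some x' y h : Pt W)
    have hval := hasValue_polyFun h (X - C x)
    rw [eval_sub, eval_X, eval_C] at hval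
    refine tame_eq_of_hasValue ?_
    rw [tameFun, hpl.ord_eq_zero_of_hasValue hval hxx, zero_mul, neg_zero, zpow_zero, zpow_zero,
      one_mul, mul_one, ord_algebraMap _ ha]
    exact hpl.hasValue_zpow hval hxx _
  rw [Finset.prod_congr rfl key, ← zpow_natCast, ← sum_fibre_ordReg ha]
  exact prod_zpow_eq_zpow_sum hxx _ _

/-! #### The product formula -/

lemma exists_tameProd_eq {f g : FunField W} (hf : f ≠ 0) (hg : g ≠ 0) :
    ∃ S₀ : Finset (AlgebraicClosure K), ∀ S, S₀ ⊆ S →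
      tameProd f g = ∏ P ∈ pointsOver W S, tame P f g := by
  classical
  obtain ⟨Sf, hSf⟩ := exists_pointsOver hf
  obtain ⟨Sg, hSg⟩ := exists_pointsOver hg
  refine ⟨Sf ∪ Sg, fun S hS => finprod_eq_prod_of_mulSupport_subset _ fun P hP => ?_⟩
  by_contra hPS
  refine hP (tame_eq_one (by_contra fun h => hPS ?_) (by_contra fun h => hPS ?_))
  · exact (hSf S (Finset.union_subset_left hS)).1 P h
  · exact (hSg S (Finset.union_subset_right hS)).1 P h

lemma tameProd_mul_left {f₁ f₂ g : FunField W} (h₁ : f₁ ≠ 0) (h₂ : f₂ ≠ 0) (hg : g ≠ 0) :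
    tameProd (f₁ * f₂) g = tameProd f₁ g * tameProd f₂ g := by
  classical
  obtain ⟨S, hS⟩ := exists_tameProd_eq (mul_ne_zero h₁ h₂) hg
  obtain ⟨S₁, hS₁⟩ := exists_tameProd_eq h₁ hg
  obtain ⟨S₂, hS₂⟩ := exists_tameProd_eq h₂ hg
  have e : S ⊆ S ∪ S₁ ∪ S₂ ∧ S₁ ⊆ S ∪ S₁ ∪ S₂ ∧ S₂ ⊆ S ∪ S₁ ∪ S₂ := by
    refine ⟨?_, ?_, ?_⟩ <;> intro s hs <;> simp [hs]
  rw [hS _ e.1, hS₁ _ e.2.1, hS₂ _ e.2.2, ← Finset.prod_mul_distrib]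
  exact Finset.prod_congr rfl fun P _ => tame_mul_left P h₁ h₂ hg

lemma tameProd_mul_swap {f g : FunField W} (hf : f ≠ 0) (hg : g ≠ 0) :
    tameProd f g * tameProd g f = 1 := by
  classical
  obtain ⟨S₁, hS₁⟩ := exists_tameProd_eq hf hg
  obtain ⟨S₂, hS₂⟩ := exists_tameProd_eq hg hf
  rw [hS₁ _ Finset.subset_union_left, hS₂ _ (Finset.subset_union_right (s₁ := S₁)),
    ← Finset.prod_mul_distrib]
  exact Finset.prod_eq_one fun P _ => tame_mul_swap P hf hg

lemma tameProd_eq_one_comm {f g : FunField W} (hf : f ≠ 0) (hg : g ≠ 0) (h : tameProd f g = 1) :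
    tameProd g f = 1 := by
  simpa [h] using tameProd_mul_swap hf hg

lemma tameProd_mul_right {f g₁ g₂ : FunField W} (hf : f ≠ 0) (h₁ : g₁ ≠ 0) (h₂ : g₂ ≠ 0) :
    tameProd f (g₁ * g₂) = tameProd f g₁ * tameProd f g₂ := by
  have e := tameProd_mul_swap (mul_ne_zero h₁ h₂) hf
  have e₁ := tameProd_mul_swap h₁ hf
  have e₂ := tameProd_mul_swap h₂ hf
  rw [tameProd_mul_left h₁ h₂ hf] at e
  refine mul_left_cancel₀ (left_ne_zero_of_mul_eq_one e) (e.trans ?_)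
  linear_combination -e₁ - tameProd g₁ f * tameProd f g₁ * e₂

/-- Symbols with a constant multiply to `1`, since divisors of functions have degree zero. -/
lemma tameProd_const {f : FunField W} (hf : f ≠ 0) {c : AlgebraicClosure K} (hc : c ≠ 0) :
    tameProd f (const W c) = 1 := by
  classical
  obtain ⟨S₁, hS₁⟩ := exists_tameProd_eq hf ((_root_.map_ne_zero (const W)).mpr hc)
  obtain ⟨S₂, hS₂⟩ := exists_pointsOver hf
  rw [hS₁ _ Finset.subset_union_left, Finset.prod_congr rfl fun P _ => tame_const P f hc,
    prod_zpow_eq_zpow_sum hc, Finset.sum_neg_distrib,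
    (hS₂ _ (Finset.subset_union_right (s₁ := S₁))).2, neg_zero, zpow_zero]

lemma eq_prod_rootMultiplicity {k : Type*} [Field k] [IsAlgClosed k] {p : k[X]} {S : Finset k}
    (hS : ∀ x, p ≠ 0 → p.IsRoot x → x ∈ S) :
    p = C p.leadingCoeff * ∏ x ∈ S, (X - C x) ^ p.rootMultiplicity x := by
  classical
  conv_lhs => rw [(IsAlgClosed.splits p).eq_prod_roots, Finset.prod_multiset_map_count]
  congr 1
  simp only [count_roots]
  refine Finset.prod_subset (fun x hx => ?_) fun x _ hx => ?_
  · have := Multiset.mem_toFinset.mp hx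
    exact hS x (ne_zero_of_mem_roots this) (isRoot_of_mem_roots this)
  · rw [← count_roots, Multiset.count_eq_zero_of_notMem fun h => hx (Multiset.mem_toFinset.mpr h),
      pow_zero]

lemma tameProd_X_sub_C_algebraMap (x : AlgebraicClosure K) {a : CoordRing W} (ha : a ≠ 0) :
    tameProd (polyFun W (X - C x)) (algebraMap _ _ a) = 1 := by
  classical
  obtain ⟨S₁, hS₁⟩ := exists_tameProd_eq (polyFun_ne_zero (W := W) (X_sub_C_ne_zero x))
    (algebraMap_ne_zero ha)
  obtain ⟨S₂, hS₂⟩ := exists_roots_subset a ha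
  set S := insert x (S₁ ∪ S₂) with hS
  have hxS : x ∈ S := Finset.mem_insert_self _ _
  have hroots : ∀ z, (Algebra.norm (AlgebraicClosure K)[X] a).IsRoot z → z ∈ S := fun z hz =>
    Finset.mem_insert_of_mem (Finset.mem_union_right _ (hS₂ z hz))
  rw [hS₁ S (Finset.subset_union_left.trans (Finset.subset_insert _ _)), prod_pointsOver,
    tame_zero_X_sub_C x ha, ← Finset.mul_prod_erase S _ hxS]
  set N := Algebra.norm (AlgebraicClosure K)[X] a with hN
  have hlc : N.leadingCoeff ≠ 0 := leadingCoeff_ne_zero.mpr (norm_ne_zero ha)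
  set m := C N.leadingCoeff * ∏ z ∈ S.erase x, (X - C z) ^ N.rootMultiplicity z with hm
  have hNm : N = (X - C x) ^ N.rootMultiplicity x * m := by
    conv_lhs => rw [eq_prod_rootMultiplicity fun z _ => hroots z, ← Finset.mul_prod_erase S _ hxS]
    rw [hm]
    ring
  have hmx : m.eval x =
      N.leadingCoeff * ∏ z ∈ S.erase x, (x - z) ^ N.rootMultiplicity z := by
    rw [hm, eval_mul, eval_C, eval_prod]
    simp
  have hprod : ∏ z ∈ S.erase x, (x - z) ^ N.rootMultiplicity z ≠ 0 :=
    Finset.prod_ne_zero_iff.mpr fun z hz => pow_ne_zero _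
      (sub_ne_zero.mpr (Finset.ne_of_mem_erase hz).symm)
  rw [prod_fibre_tame_X_sub_C ha (hmx ▸ mul_ne_zero hlc hprod) hNm,
    Finset.prod_congr rfl fun z hz =>
      prod_fibre_tame_X_sub_C_of_ne (Finset.ne_of_mem_erase hz) ha, ← hN, hmx,
    ← natDegree_eq_sum_rootMultiplicity fun z _ => hroots z, ← Finset.add_sum_erase S _ hxS,
    pow_add, ← Finset.prod_pow_eq_pow_sum]
  -- the signs turn each `x - z` into `z - x`
  have hsign : ∏ z ∈ S.erase x, (z - x) ^ N.rootMultiplicity z =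
      (∏ z ∈ S.erase x, (-1) ^ N.rootMultiplicity z) *
        ∏ z ∈ S.erase x, (x - z) ^ N.rootMultiplicity z := by
    rw [← Finset.prod_mul_distrib]
    exact Finset.prod_congr rfl fun z _ => by rw [← mul_pow, neg_one_mul, neg_sub]
  have h1 : ((-1 : AlgebraicClosure K) ^ N.rootMultiplicity x) *
      (-1) ^ N.rootMultiplicity x = 1 := by rw [← mul_pow]; simp
  have h2 : (∏ z ∈ S.erase x, (-1 : AlgebraicClosure K) ^ N.rootMultiplicity z) *
      ∏ z ∈ S.erase x, (-1) ^ N.rootMultiplicity z = 1 := by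
    rw [← Finset.prod_mul_distrib]
    exact Finset.prod_eq_one fun z _ => by rw [← mul_pow]; simp
  rw [hsign]
  set p₁ := ∏ z ∈ S.erase x, (x - z) ^ N.rootMultiplicity z
  set p₂ := ∏ z ∈ S.erase x, (-1 : AlgebraicClosure K) ^ N.rootMultiplicity z
  set e := (-1 : AlgebraicClosure K) ^ N.rootMultiplicity x
  rw [mul_inv]
  have h3 : N.leadingCoeff * N.leadingCoeff⁻¹ = 1 := mul_inv_cancel₀ hlc
  have h4 : p₁ * p₁⁻¹ = 1 := mul_inv_cancel₀ hprod
  calc _ = (e * e) * (p₂ * p₂) * (N.leadingCoeff * N.leadingCoeff⁻¹) * (p₁ * p₁⁻¹) := by ring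
    _ = 1 := by rw [h1, h2, h3, h4]; norm_num

/-- Reciprocity on the curve with the second function a polynomial in `x`. -/
lemma tameProd_polyFun {f : FunField W} (hf : f ≠ 0) {p : (AlgebraicClosure K)[X]} (hp : p ≠ 0) :
    tameProd f (polyFun W p) = 1 := by
  refine induction_of_isAlgClosed (motive := fun p => tameProd f (polyFun W p) = 1)
    (fun c hc => tameProd_const hf hc) (fun x p hp ih => ?_) hp
  have hx := polyFun_ne_zero (W := W) (X_sub_C_ne_zero x)
  rw [polyFun_mul, tameProd_mul_right hf hx (polyFun_ne_zero hp), ih, mul_one]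
  obtain ⟨a, b, ha, hb, hab⟩ := exists_mul_eq hf
  have h := tameProd_mul_left hf (algebraMap_ne_zero hb) hx
  rw [hab, tameProd_eq_one_comm hx (algebraMap_ne_zero ha) (tameProd_X_sub_C_algebraMap x ha),
    tameProd_eq_one_comm hx (algebraMap_ne_zero hb) (tameProd_X_sub_C_algebraMap x hb),
    mul_one] at h
  exact h.symm

lemma tameProd_neg_right {f g : FunField W} (hf : f ≠ 0) (hg : g ≠ 0) :
    tameProd f (-g) = tameProd f g := by
  have h1 : (-1 : AlgebraicClosure K) ≠ 0 := neg_ne_zero.mpr one_ne_zero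
  have h := tameProd_mul_right hf ((_root_.map_ne_zero (const W)).mpr h1) hg
  rwa [tameProd_const hf h1, one_mul, map_neg, map_one, neg_one_mul] at h

/-- If two functions differ by a polynomial in `x`, the Steinberg relation applies to their
quotients by it. -/
lemma tameProd_eq_one_of_sub_eq_polyFun {f g : FunField W} (hf : f ≠ 0) (hg : g ≠ 0)
    {p : (AlgebraicClosure K)[X]} (h : f - g = polyFun W p) : tameProd f g = 1 := by
  rcases eq_or_ne p 0 with rfl | hp
  · rw [show polyFun W 0 = 0 by simp [polyFun], sub_eq_zero] at h
    rw [← h, ← tameProd_neg_right hf hf, tameProd_neg_self hf]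
  · have hc := polyFun_ne_zero (W := W) hp
    set c := polyFun W p with hcdef
    have hf' : f / c ≠ 0 := div_ne_zero hf hc
    have hg' : -g / c ≠ 0 := div_ne_zero (neg_ne_zero.mpr hg) hc
    have hst := tameProd_eq_one_of_add_eq_one hf' hg' (by
      rw [← add_div, ← sub_eq_add_neg, h, div_self hc])
    rw [← tameProd_neg_right hf hg]
    have e1 := tameProd_mul_left hc hf' (neg_ne_zero.mpr hg)
    have e2 := tameProd_mul_right hf' hc hg'
    rw [mul_div_cancel₀ _ hc] at e1 e2
    rw [e1, e2, hst, tameProd_polyFun hf' hp,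
      tameProd_eq_one_comm (neg_ne_zero.mpr hg) hc (tameProd_polyFun (neg_ne_zero.mpr hg) hp)]
    norm_num

lemma tameProd_algebraMap {a b : CoordRing W} (ha : a ≠ 0) (hb : b ≠ 0) :
    tameProd (algebraMap _ (FunField W) a) (algebraMap _ (FunField W) b) = 1 := by
  have ha' := algebraMap_ne_zero ha
  have hb' := algebraMap_ne_zero hb
  obtain ⟨p₁, q₁, h₁⟩ := exists_smul_basis_eq a
  obtain ⟨p₂, q₂, h₂⟩ := exists_smul_basis_eq b
  have e₁ : algebraMap _ (FunField W) a =
      polyFun W p₁ + polyFun W q₁ * algebraMap _ _ (CoordinateRing.mk (Ebar W) Y) := by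
    rw [← h₁, CoordinateRing.smul, CoordinateRing.smul, map_add, map_mul, map_mul, map_one, mul_one]
    rfl
  have e₂ : algebraMap _ (FunField W) b =
      polyFun W p₂ + polyFun W q₂ * algebraMap _ _ (CoordinateRing.mk (Ebar W) Y) := by
    rw [← h₂, CoordinateRing.smul, CoordinateRing.smul, map_add, map_mul, map_mul, map_one, mul_one]
    rfl
  have hzero : polyFun W 0 = 0 := by simp [polyFun]
  rcases eq_or_ne q₁ 0 with rfl | hq₁
  · rw [hzero, zero_mul, add_zero] at e₁
    have hp : p₁ ≠ 0 := by rintro rfl; exact ha' (by rw [e₁, hzero])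
    rw [e₁]
    exact tameProd_eq_one_comm hb' (polyFun_ne_zero hp) (tameProd_polyFun hb' hp)
  rcases eq_or_ne q₂ 0 with rfl | hq₂
  · rw [hzero, zero_mul, add_zero] at e₂
    have hp : p₂ ≠ 0 := by rintro rfl; exact hb' (by rw [e₂, hzero])
    rw [e₂]
    exact tameProd_polyFun ha' hp
  have hq₁' := polyFun_ne_zero (W := W) hq₁
  have hq₂' := polyFun_ne_zero (W := W) hq₂
  -- multiplying by polynomials in `x` makes the coefficients of `y` agree
  have key := tameProd_eq_one_of_sub_eq_polyFun (mul_ne_zero hq₂' ha') (mul_ne_zero hq₁' hb')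
    (p := q₂ * p₁ - q₁ * p₂) (by rw [polyFun_sub, polyFun_mul, polyFun_mul, e₁, e₂]; ring)
  rwa [tameProd_mul_right (mul_ne_zero hq₂' ha') hq₁' hb',
    tameProd_polyFun (mul_ne_zero hq₂' ha') hq₁, one_mul, tameProd_mul_left hq₂' ha' hb',
    tameProd_eq_one_comm hb' hq₂' (tameProd_polyFun hb' hq₂), one_mul] at key

/-- Weil reciprocity, as the product formula for tame symbols. -/
theorem tameProd_eq_one {f g : FunField W} (hf : f ≠ 0) (hg : g ≠ 0) : tameProd f g = 1 := by
  have main : ∀ {f : FunField W}, f ≠ 0 → ∀ {b : CoordRing W}, b ≠ 0 →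
      tameProd (algebraMap _ _ b) f = 1 := fun {f} hf {b} hb => by
    obtain ⟨c, d, hc, hd, hcd⟩ := exists_mul_eq hf
    have h := tameProd_mul_right (algebraMap_ne_zero hb) hf (algebraMap_ne_zero hd)
    rw [hcd, tameProd_algebraMap hb hc, tameProd_algebraMap hb hd, mul_one] at h
    exact h.symm
  obtain ⟨a, b, ha, hb, hab⟩ := exists_mul_eq hf
  have h := tameProd_mul_left hf (algebraMap_ne_zero hb) hg
  rw [hab, main hg ha, main hg hb, mul_one] at h
  exact h.symm

end Reciprocity

/-! ### The pairings -/

section Pairings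

variable {K : Type*} [Field K] {W : WeierstrassCurve K} (u : Uniformizers W)

lemma mul_uniformizer_zpow_ne_zero {f : FunField W} (hf : f ≠ 0) (P : Pt W) (n : ℤ) :
    f * u.t P ^ n ≠ 0 :=
  mul_ne_zero hf (zpow_ne_zero _ (u.ne_zero P))

lemma ord_mul_uniformizer_zpow {f : FunField W} (hf : f ≠ 0) (P : Pt W) :
    ord P (f * u.t P ^ (-ord P f)) = 0 := by
  have h := isPlace_ord P
  rw [h.mul hf (zpow_ne_zero _ (u.ne_zero P)), h.map_zpow (u.ne_zero P), u.ord_eq_one P]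
  ring

lemma hasValue_leadCoeff {f : FunField W} (hf : f ≠ 0) (P : Pt W) :
    HasValue (const W) (ord P) (f * u.t P ^ (-ord P f)) (leadCoeff u f P) :=
  hasValue_value (mul_uniformizer_zpow_ne_zero u hf P _) (ord_mul_uniformizer_zpow u hf P)

lemma leadCoeff_ne_zero {f : FunField W} (hf : f ≠ 0) (P : Pt W) : leadCoeff u f P ≠ 0 :=
  value_ne_zero (mul_uniformizer_zpow_ne_zero u hf P _) (ord_mul_uniformizer_zpow u hf P)

lemma leadCoeff_mul {f g : FunField W} (hf : f ≠ 0) (hg : g ≠ 0) (P : Pt W) :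
    leadCoeff u (f * g) P = leadCoeff u f P * leadCoeff u g P := by
  refine value_eq ?_
  convert (isPlace_ord P).hasValue_mul (hasValue_leadCoeff u hf P) (hasValue_leadCoeff u hg P)
    using 1
  rw [(isPlace_ord P).mul hf hg, neg_add, zpow_add₀ (u.ne_zero P)]
  ring

lemma leadCoeff_const {c : AlgebraicClosure K} (hc : c ≠ 0) (P : Pt W) :
    leadCoeff u (const W c) P = c := by
  refine value_eq ?_
  rw [(isPlace_ord P).const hc, neg_zero, zpow_zero, mul_one]
  exact IsPlace.hasValue_const

lemma leadCoeff_galFun (σ : GalK K) {f : FunField W} (hf : f ≠ 0) (P : Pt W) :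
    leadCoeff u (galFun W σ f) (galPt σ P) = σ (leadCoeff u f P) := by
  have := value_galFun σ (mul_uniformizer_zpow_ne_zero u hf P _) (ord_mul_uniformizer_zpow u hf P)
  rw [leadCoeff, ord_galFun σ P hf, u.equivariant, ← map_zpow₀, ← map_mul, this]
  rfl

/-- The tame symbol in terms of leading coefficients: the uniformizer cancels. -/
lemma leadCoeff_zpow_eq_tame_mul {f g : FunField W} (hf : f ≠ 0) (hg : g ≠ 0) (P : Pt W) :
    leadCoeff u f P ^ ord P g =
      tame P f g * ((-1) ^ (ord P g * ord P f) * leadCoeff u g P ^ ord P f) := by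
  have h := isPlace_ord P
  have ht := u.ne_zero P
  have htame : tame P f g =
      (-1) ^ (ord P f * ord P g) * (leadCoeff u f P ^ ord P g * leadCoeff u g P ^ (-ord P f)) := by
    refine tame_eq_of_hasValue ?_
    convert h.hasValue_mul (IsPlace.hasValue_neg_one_zpow _) (h.hasValue_mul
      (h.hasValue_zpow (hasValue_leadCoeff u hf P) (leadCoeff_ne_zero u hf P) (ord P g))
      (h.hasValue_zpow (hasValue_leadCoeff u hg P) (leadCoeff_ne_zero u hg P) (-ord P f))) using 1
    have hcancel : (u.t P ^ (-ord P f)) ^ ord P g * (u.t P ^ (-ord P g)) ^ (-ord P f) = 1 := by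
      rw [← zpow_mul, ← zpow_mul, ← zpow_add₀ ht]
      ring_nf
      exact zpow_zero _
    rw [tameFun, mul_zpow, mul_zpow]
    linear_combination (-(-1 : FunField W) ^ (ord P f * ord P g) * f ^ ord P g *
      g ^ (-ord P f)) * hcancel
  have h1 : (-1 : AlgebraicClosure K) ^ (ord P f * ord P g) * (-1) ^ (ord P f * ord P g) = 1 := by
    rw [← mul_zpow]
    simp
  have h2 : leadCoeff u g P ^ (-ord P f) * leadCoeff u g P ^ ord P f = 1 := by
    rw [← zpow_add₀ (leadCoeff_ne_zero u hg P)]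
    simp
  rw [htame, mul_comm (ord P g)]
  linear_combination (-leadCoeff u f P ^ ord P g) * h1 - (-1) ^ (ord P f * ord P g) *
    (-1) ^ (ord P f * ord P g) * leadCoeff u f P ^ ord P g * h2

/-! #### Multiplicativity and equivariance of the formulas -/

/-- The sign by which the second formula differs from the first. -/
noncomputable def signFactor (f : FunField W) (D : Divisor W) : AlgebraicClosure K :=
  D.prod fun P n => (-1) ^ (ord P f * n)

lemma formula₂_eq (f : FunField W) (D : Divisor W) :
    formula₂ u D f = signFactor f D * formula₁ u f D :=
  Finsupp.prod_mul

lemma neg_one_ne_zero' : (-1 : AlgebraicClosure K) ≠ 0 := neg_ne_zero.mpr one_ne_zero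

lemma formula₁_ne_zero {f : FunField W} (hf : f ≠ 0) (D : Divisor W) : formula₁ u f D ≠ 0 :=
  Finset.prod_ne_zero_iff.mpr fun P _ => zpow_ne_zero _ (leadCoeff_ne_zero u hf P)

lemma signFactor_ne_zero (f : FunField W) (D : Divisor W) : signFactor f D ≠ 0 :=
  Finset.prod_ne_zero_iff.mpr fun _ _ => zpow_ne_zero _ neg_one_ne_zero'

lemma formula₁_mul {f g : FunField W} (hf : f ≠ 0) (hg : g ≠ 0) (D : Divisor W) :
    formula₁ u (f * g) D = formula₁ u f D * formula₁ u g D := by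
  simp only [formula₁, leadCoeff_mul u hf hg, mul_zpow, Finsupp.prod_mul]

lemma signFactor_mul {f g : FunField W} (hf : f ≠ 0) (hg : g ≠ 0) (D : Divisor W) :
    signFactor (f * g) D = signFactor f D * signFactor g D := by
  simp only [signFactor, (isPlace_ord _).mul hf hg, add_mul, zpow_add₀ neg_one_ne_zero',
    Finsupp.prod_mul]

lemma formula₁_add {f : FunField W} (hf : f ≠ 0) (D D' : Divisor W) :
    formula₁ u f (D + D') = formula₁ u f D * formula₁ u f D' :=
  Finsupp.prod_add_index' (fun _ => zpow_zero _) fun P _ _ =>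
    zpow_add₀ (leadCoeff_ne_zero u hf P) _ _

lemma signFactor_add (f : FunField W) (D D' : Divisor W) :
    signFactor f (D + D') = signFactor f D * signFactor f D' :=
  Finsupp.prod_add_index' (fun _ => by simp) fun P m n => by
    rw [mul_add, zpow_add₀ neg_one_ne_zero']

/-- On divisors of degree zero the formulas do not see constant factors. -/
lemma formula₁_const_mul {f : FunField W} (hf : f ≠ 0) {c : AlgebraicClosure K} (hc : c ≠ 0)
    {D : Divisor W} (hD : D ∈ Div0 W) : formula₁ u (const W c * f) D = formula₁ u f D := by
  have h : formula₁ u (const W c) D = 1 := by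
    simp only [formula₁, leadCoeff_const u hc]
    rw [Finsupp.prod, prod_zpow_eq_zpow_sum hc, show ∑ P ∈ D.support, D P = 0 from hD, zpow_zero]
  rw [formula₁_mul u ((_root_.map_ne_zero _).mpr hc) hf, h, one_mul]

lemma formula₁_galFun (σ : GalK K) {f : FunField W} (hf : f ≠ 0) (D : Divisor W) :
    formula₁ u (galFun W σ f) (galDiv σ D) = σ (formula₁ u f D) := by
  rw [formula₁, galDiv, Finsupp.prod_mapDomain_index_inj (galPt_injective σ), formula₁,
    map_finsuppProd]
  simp only [leadCoeff_galFun u σ hf, map_zpow₀]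

lemma signFactor_galFun (σ : GalK K) {f : FunField W} (hf : f ≠ 0) (D : Divisor W) :
    signFactor (galFun W σ f) (galDiv σ D) = σ (signFactor f D) := by
  rw [signFactor, galDiv, Finsupp.prod_mapDomain_index_inj (galPt_injective σ), signFactor,
    map_finsuppProd]
  simp only [ord_galFun σ _ hf, map_zpow₀, map_neg, map_one]

/-! #### Principal divisors -/

lemma IsDivOf.add {A B : Divisor W} {f g : FunField W} (hA : IsDivOf A f) (hB : IsDivOf B g) :
    IsDivOf (A + B) (f * g) :=
  ⟨mul_ne_zero hA.1 hB.1, fun P => by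
    rw [Finsupp.add_apply, hA.2, hB.2, (isPlace_ord P).mul hA.1 hB.1]⟩

lemma isDivOf_zero : IsDivOf (0 : Divisor W) 1 :=
  ⟨one_ne_zero, fun P => (isPlace_ord P).map_one.symm⟩

lemma IsDivOf.neg {A : Divisor W} {f : FunField W} (hA : IsDivOf A f) : IsDivOf (-A) f⁻¹ :=
  ⟨inv_ne_zero hA.1, fun P => by rw [Finsupp.neg_apply, hA.2, (isPlace_ord P).map_inv hA.1]⟩

lemma galPt_surjective (σ : GalK K) : Function.Surjective (galPt (W := W) σ) := by
  intro P
  refine ⟨galPt σ⁻¹ P, ?_⟩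
  rcases P with _ | ⟨x, y, h⟩
  · rfl
  · obtain ⟨h', e⟩ := galPt_some σ⁻¹ h
    obtain ⟨h'', e'⟩ := galPt_some σ h'
    rw [e, e']
    congr 1 <;> exact σ.apply_symm_apply _

lemma IsDivOf.galDiv (σ : GalK K) {A : Divisor W} {f : FunField W} (hA : IsDivOf A f) :
    IsDivOf (galDiv σ A) (galFun W σ f) := by
  refine ⟨(_root_.map_ne_zero _).mpr hA.1, fun P => ?_⟩
  obtain ⟨Q, rfl⟩ := galPt_surjective σ P
  rw [EllPairing.galDiv, Finsupp.mapDomain_apply (galPt_injective σ), hA.2, ord_galFun σ Q hA.1]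

lemma degree_galDiv (σ : GalK K) (D : Divisor W) : degree (galDiv σ D) = degree D :=
  Finsupp.sum_mapDomain_index_inj (galPt_injective σ)

lemma degree_add (D D' : Divisor W) : degree (D + D') = degree D + degree D' :=
  Finsupp.sum_add_index' (fun _ => rfl) fun _ _ _ => rfl

lemma degree_neg (D : Divisor W) : degree (-D) = -degree D := by
  have := degree_add D (-D)
  rw [add_neg_cancel, show degree (0 : Divisor W) = 0 from Finsupp.sum_zero_index] at this
  omega

variable (W) in
lemma exists_addSubgroup_eq_Div0 :
    ∃ S : AddSubgroup (Divisor W), (S : Set (Divisor W)) = Div0 W :=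
  ⟨{ carrier := Div0 W
     zero_mem' := Finsupp.sum_zero_index
     add_mem' := fun {D D'} (hD : degree D = 0) (hD' : degree D' = 0) =>
       show degree (D + D') = 0 by rw [degree_add, hD, hD', add_zero]
     neg_mem' := fun {D} (hD : degree D = 0) =>
       show degree (-D) = 0 by rw [degree_neg, hD, neg_zero] }, rfl⟩

variable (W) in
lemma exists_addSubgroup_eq_Princ :
    ∃ S : AddSubgroup (Divisor W), (S : Set (Divisor W)) = Princ W :=
  ⟨{ carrier := Princ W
     zero_mem' := ⟨1, isDivOf_zero⟩
     add_mem' := fun ⟨f, hf⟩ ⟨g, hg⟩ => ⟨f * g, hf.add hg⟩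
     neg_mem' := fun ⟨f, hf⟩ => ⟨f⁻¹, hf.neg⟩ }, rfl⟩

lemma galDiv_mem_Div0 (σ : GalK K) {D : Divisor W} (hD : D ∈ Div0 W) : galDiv σ D ∈ Div0 W :=
  (degree_galDiv σ D).trans hD

lemma galDiv_mem_Princ (σ : GalK K) {D : Divisor W} (hD : D ∈ Princ W) : galDiv σ D ∈ Princ W :=
  hD.imp' (galFun W σ) fun _ hf => hf.galDiv σ

variable [W.IsElliptic]

lemma Princ_subset_Div0 : Princ W ⊆ Div0 W := fun _ ⟨_, hf⟩ => degree_eq_zero_of_isDivOf hf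

/-- A divisor determines its function up to a constant. -/
lemma IsDivOf.exists_eq_const_mul {A : Divisor W} {f g : FunField W} (hf : IsDivOf A f)
    (hg : IsDivOf A g) : ∃ c, c ≠ 0 ∧ g = const W c * f := by
  obtain ⟨c, hc, h⟩ := exists_eq_const (div_ne_zero hg.1 hf.1) fun P => by
    rw [(isPlace_ord P).map_div hg.1 hf.1, ← hf.2, ← hg.2, sub_self]
  exact ⟨c, hc, by rw [← h, div_mul_cancel₀ _ hf.1]⟩

lemma formula₁_eq_of_isDivOf {A D : Divisor W} {f g : FunField W} (hf : IsDivOf A f)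
    (hg : IsDivOf A g) (hD : D ∈ Div0 W) : formula₁ u g D = formula₁ u f D := by
  obtain ⟨c, hc, rfl⟩ := hf.exists_eq_const_mul hg
  exact formula₁_const_mul u hf.1 hc hD

lemma pairing₁_eq {A D : Divisor W} {f : FunField W} (hf : IsDivOf A f) (hD : D ∈ Div0 W) :
    pairing₁ u A D = formula₁ u f D := by
  have hex : ∃ f, IsDivOf A f := ⟨f, hf⟩
  rw [pairing₁, dif_pos hex]
  exact formula₁_eq_of_isDivOf u hf hex.choose_spec hD

lemma pairing₂_eq {A D : Divisor W} {f : FunField W} (hf : IsDivOf A f) (hD : D ∈ Div0 W) :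
    pairing₂ u D A = formula₂ u D f := by
  have hex : ∃ f, IsDivOf A f := ⟨f, hf⟩
  rw [pairing₂, dif_pos hex, formula₂_eq, formula₂_eq,
    formula₁_eq_of_isDivOf u hf hex.choose_spec hD, signFactor, signFactor]
  simp only [← hf.2, ← hex.choose_spec.2]

lemma isGaloisPairing_pairing₁ : IsGaloisPairing (Princ W) (Div0 W) (pairing₁ u) where
  subgroup_left := exists_addSubgroup_eq_Princ W
  subgroup_right := exists_addSubgroup_eq_Div0 W
  stable_left σ _ hD := galDiv_mem_Princ σ hD
  stable_right σ _ hD := galDiv_mem_Div0 σ hD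
  ne_zero := fun _ ⟨_, hf⟩ _ hD => pairing₁_eq u hf hD ▸ formula₁_ne_zero u hf.1 _
  add_left := fun _ ⟨_, hf⟩ _ ⟨_, hg⟩ _ hD => by
    rw [pairing₁_eq u hf hD, pairing₁_eq u hg hD, pairing₁_eq u (hf.add hg) hD,
      formula₁_mul u hf.1 hg.1]
  add_right := fun _ ⟨_, hf⟩ D₁ (h₁ : degree D₁ = 0) D₂ (h₂ : degree D₂ = 0) => by
    have h : D₁ + D₂ ∈ Div0 W := show degree (D₁ + D₂) = 0 by rw [degree_add, h₁, h₂, add_zero]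
    rw [pairing₁_eq u hf h₁, pairing₁_eq u hf h₂, pairing₁_eq u hf h, formula₁_add u hf.1]
  equivariant := fun σ _ ⟨_, hf⟩ _ hD => by
    rw [pairing₁_eq u hf hD, pairing₁_eq u (hf.galDiv σ) (galDiv_mem_Div0 σ hD),
      formula₁_galFun u σ hf.1]

lemma isGaloisPairing_pairing₂ : IsGaloisPairing (Div0 W) (Princ W) (pairing₂ u) where
  subgroup_left := exists_addSubgroup_eq_Div0 W
  subgroup_right := exists_addSubgroup_eq_Princ W
  stable_left σ _ hD := galDiv_mem_Div0 σ hD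
  stable_right σ _ hD := galDiv_mem_Princ σ hD
  ne_zero := fun _ hD _ ⟨_, hf⟩ => by
    rw [pairing₂_eq u hf hD, formula₂_eq]
    exact mul_ne_zero (signFactor_ne_zero _ _) (formula₁_ne_zero u hf.1 _)
  add_left := fun D₁ (h₁ : degree D₁ = 0) D₂ (h₂ : degree D₂ = 0) _ ⟨_, hf⟩ => by
    have h : D₁ + D₂ ∈ Div0 W := show degree (D₁ + D₂) = 0 by rw [degree_add, h₁, h₂, add_zero]
    rw [pairing₂_eq u hf h₁, pairing₂_eq u hf h₂, pairing₂_eq u hf h, formula₂_eq, formula₂_eq,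
      formula₂_eq, formula₁_add u hf.1, signFactor_add]
    ring
  add_right := fun _ hD _ ⟨_, hf⟩ _ ⟨_, hg⟩ => by
    rw [pairing₂_eq u hf hD, pairing₂_eq u hg hD, pairing₂_eq u (hf.add hg) hD, formula₂_eq,
      formula₂_eq, formula₂_eq, formula₁_mul u hf.1 hg.1, signFactor_mul hf.1 hg.1]
    ring
  equivariant := fun σ _ hD _ ⟨_, hf⟩ => by
    rw [pairing₂_eq u hf hD, pairing₂_eq u (hf.galDiv σ) (galDiv_mem_Div0 σ hD), formula₂_eq,
      formula₂_eq, formula₁_galFun u σ hf.1, signFactor_galFun σ hf.1, map_mul]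

/-- The quotient of the two sides is the product of the tame symbols of `f` and `g`. -/
lemma formula₁_eq_formula₂ {A B : Divisor W} {f g : FunField W} (hf : IsDivOf A f)
    (hg : IsDivOf B g) : formula₁ u f B = formula₂ u A g := by
  classical
  obtain ⟨S₁, h₁⟩ := exists_pointsOver hf.1
  obtain ⟨S₂, h₂⟩ := exists_pointsOver hg.1
  obtain ⟨S₃, h₃⟩ := exists_tameProd_eq hf.1 hg.1
  set S := S₁ ∪ S₂ ∪ S₃ with hS
  have e : S₁ ⊆ S ∧ S₂ ⊆ S ∧ S₃ ⊆ S := by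
    refine ⟨?_, ?_, ?_⟩ <;> intro s hs <;> simp [hS, hs]
  have hA : A.support ⊆ pointsOver W S := fun P hP =>
    (h₁ S e.1).1 P (hf.2 P ▸ Finsupp.mem_support_iff.mp hP)
  have hB : B.support ⊆ pointsOver W S := fun P hP =>
    (h₂ S e.2.1).1 P (hg.2 P ▸ Finsupp.mem_support_iff.mp hP)
  rw [formula₁, formula₂, Finsupp.prod_of_support_subset _ hA _ fun _ _ => by simp,
    Finsupp.prod_of_support_subset _ hB _ fun _ _ => by simp]
  simp only [hf.2, hg.2]
  rw [Finset.prod_congr rfl fun P _ => leadCoeff_zpow_eq_tame_mul u hf.1 hg.1 P,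
    Finset.prod_mul_distrib, ← h₃ S e.2.2, tameProd_eq_one hf.1 hg.1, one_mul]

end Pairings

end EllPairing

theorem mainTheorem6 {K : Type*} [Field K] [PerfectField K] (W : WeierstrassCurve K)
    [W.IsElliptic] (u : EllPairing.Uniformizers W) :
    -- every nonzero function has a divisor, and it is of degree zero
    (∀ f : EllPairing.FunField W, f ≠ 0 → ∃ D ∈ EllPairing.Div0 W, EllPairing.IsDivOf D f) ∧
    -- the two pairings do not depend on the function chosen to represent a principal divisor
    (∀ (f : EllPairing.FunField W) (A : EllPairing.Divisor W), EllPairing.IsDivOf A f →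
      ∀ D ∈ EllPairing.Div0 W,
        EllPairing.pairing₁ u A D = EllPairing.formula₁ u f D ∧
        EllPairing.pairing₂ u D A = EllPairing.formula₂ u D f) ∧
    -- they are Galois-equivariant pairings, defined everywhere
    EllPairing.IsGaloisPairing (EllPairing.Princ W) (EllPairing.Div0 W)
      (EllPairing.pairing₁ u) ∧
    EllPairing.IsGaloisPairing (EllPairing.Div0 W) (EllPairing.Princ W)
      (EllPairing.pairing₂ u) ∧
    -- they agree on principal divisors
    (∀ A ∈ EllPairing.Princ W, ∀ B ∈ EllPairing.Princ W,
      EllPairing.pairing₁ u A B = EllPairing.pairing₂ u A B) := by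
  refine ⟨fun f hf => ?_, fun f A hA D hD =>
    ⟨EllPairing.pairing₁_eq u hA hD, EllPairing.pairing₂_eq u hA hD⟩,
    EllPairing.isGaloisPairing_pairing₁ u, EllPairing.isGaloisPairing_pairing₂ u, ?_⟩
  · obtain ⟨D, hD⟩ := EllPairing.exists_isDivOf hf
    exact ⟨D, EllPairing.degree_eq_zero_of_isDivOf hD, hD⟩
  · rintro A ⟨f, hf⟩ B ⟨g, hg⟩
    rw [EllPairing.pairing₁_eq u hf (EllPairing.Princ_subset_Div0 ⟨g, hg⟩),
      EllPairing.pairing₂_eq u hg (EllPairing.Princ_subset_Div0 ⟨f, hf⟩),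
      EllPairing.formula₁_eq_formula₂ u hf hg]
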